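/- Let $n,d\ge 1$ be integers and let $\mathbb R^{2n+3}_1$ be $\mathbb R^{2n+3}$ with the Lorentzian metric $\langle x,y\rangle_L=-x_{2n+3}y_{2n+3}+\sum_{k=1}^{2n+2}x_ky_k$. Put $U^{2n+3}=\{x\mid\langle x,x\rangle_L<0\}$ and $H^{2n+2}=\{x\mid\langle x,x\rangle_L=-1\}$ (both sheets), the latter with the induced Riemannian metric, and let $\pi^*:U^{2n+3}\to H^{2n+2}$, $\pi^*(x)=x/\sqrt{-\langle x,x\rangle_L}$. A smooth map $\phi:M\to\mathbb C$ from a semi-Riemannian manifold is a harmonic morphism if for every harmonic function $f:W\to\mathbb R$ on an open set $W\subset\mathbb C$ with $\phi^{-1}(W)\neq\emptyset$ the composition $f\circ\phi:\phi^{-1}(W)\to\mathbb R$ is harmonic with respect to the Laplace-Beltrami operator of $M$. Let $p:\mathbb R^3\to\mathbb C$, $$p(x)=a_1(x_1^2-x_2^2)+a_2(x_2^2-x_3^2)+b_1x_1x_2+b_2x_1x_3+b_3x_2x_3,\qquad a_1,a_2,b_1,b_2,b_3\in\mathbb C .$$ Then $p$ is horizontally conformal, i.e. $\kappa(p,p)=\sum_{k=1}^3(\partial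 p/\partial x_k)^2=0$ on $\mathbb R^3$, if and only if $$4a_1^2+b_1^2+b_2^2=0,\quad 4a_1a_2=-b_2^2,\quad 2a_1b_3=b_1b_2,\quad 4a_2^2+b_2^2+b_3^2=0 .$$ Assume that $\kappa(p,p)=0$, and let $P_d,Q_d\in\mathbb C[z_1,\dots,z_n]$ be homogeneous polynomials of degree $d$ (the zero polynomial is allowed). Set $z_k=x_{2k+2}+i\,x_{2k+3}$ for $1\le k<n$ and $z_n=x_{2n+2}-x_{2n+3}$. Let $V$ be the set of all $x\in U^{2n+3}$ with $Q_d(z)\neq0$ and, if $d$ is odd, $p(x_1,x_2,x_3)\notin(-\infty,0]$. Define $$\hat\Phi^*_d:V\to\mathbb C,\qquad \hat\Phi_d^*(x)=\frac{p(x_1,x_2,x_3)^{d/2}+P_d(z_1,\dots,z_n)}{Q_d(z_1,\dots,z_n)},$$ where $p^{d/2}=(\sqrt p)^d$ with the standard square root if $d$ is odd. Then: 1. $V$ is open and $\hat\Phi_d^*$ is a harmonic morphism on $V\subset\mathbb R^{2n+3}_1$. 2. $V$ and $\hat\Phi^*_d$ are invariant under multiplication by positive real numbers, and $\hat\Phi_d^*$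 induces a harmonic morphism on an open subset of $H^{2n+2}$: $\pi^*(V)$ is open in $H^{2n+2}$ and there is a harmonic morphism $\Phi_d^*:\pi^*(V)\to\mathbb C$ with $\Phi^*_d\circ\pi^*=\hat\Phi^*_d$ on $V$. 3. If $d$ is even and $Q_d=z_n^d$, then $V=U^{2n+3}$ and $\pi^*(V)=H^{2n+2}$, so that $\hat\Phi_d^*$ is defined on all of $U^{2n+3}$ and $\Phi_d^*$ on all of $H^{2n+2}$. -/

import Mathlib

open scoped ContDiff

noncomputable section

namespace HarmonicMorphism

/-! ### Coordinate calculus -/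

/-- The partial derivative `∂u/∂x_i` at the point `x`. -/
def pderiv {m : ℕ} {F : Type*} [NormedAddCommGroup F] [NormedSpace ℝ F]
    (i : Fin m) (u : (Fin m → ℝ) → F) (x : Fin m → ℝ) : F :=
  fderiv ℝ u x (Pi.single i 1)

/-- The conformality operator `κ(φ, ψ) = ∑ₖ ∂φ/∂xₖ · ∂ψ/∂xₖ` of Euclidean space `ℝᵐ`. -/
def kappa {m : ℕ} (φ ψ : (Fin m → ℝ) → ℂ) (x : Fin m → ℝ) : ℂ :=
  ∑ k, pderiv k φ x * pderiv k ψ x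

/-- The Laplace-Beltrami operator (tension field) of a semi-Riemannian metric `G = (g_ij)`
given in coordinates:
`Δf = |det G|^(-1/2) ∑ᵢ ∂ᵢ ( |det G|^(1/2) ∑ⱼ g^{ij} ∂ⱼ f )`. -/
def laplaceBeltrami {m : ℕ} (G : (Fin m → ℝ) → Matrix (Fin m) (Fin m) ℝ)
    (f : (Fin m → ℝ) → ℝ) (x : Fin m → ℝ) : ℝ :=
  (√|(G x).det|)⁻¹ *
    ∑ i, pderiv i (fun y => √|(G y).det| * ∑ j, (G y)⁻¹ i j * pderiv j f y) x

/-- `f` is a harmonic function on the open set `Ω ⊆ ℝᵐ` equipped with the metric `G`. -/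
def IsHarmonicOn {m : ℕ} (G : (Fin m → ℝ) → Matrix (Fin m) (Fin m) ℝ)
    (f : (Fin m → ℝ) → ℝ) (Ω : Set (Fin m → ℝ)) : Prop :=
  ContDiffOn ℝ 2 f Ω ∧ ∀ x ∈ Ω, laplaceBeltrami G f x = 0

/-- `φ` is a (smooth) harmonic morphism from the open set `Ω ⊆ ℝᵐ`, equipped with the metric `G`,
to the Euclidean plane `ℂ`: it pulls back harmonic functions on open subsets `W` of `ℂ` with
non-empty preimage to harmonic functions. -/
def IsHarmonicMorphismOn {m : ℕ} (G : (Fin m → ℝ) → Matrix (Fin m) (Fin m) ℝ)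
    (φ : (Fin m → ℝ) → ℂ) (Ω : Set (Fin m → ℝ)) : Prop :=
  IsOpen Ω ∧ ContDiffOn ℝ ∞ φ Ω ∧
    ∀ (W : Set ℂ) (f : ℂ → ℝ), IsOpen W → (Ω ∩ φ ⁻¹' W).Nonempty →
      InnerProductSpace.HarmonicOnNhd f W → IsHarmonicOn G (f ∘ φ) (Ω ∩ φ ⁻¹' W)

/-! ### Minkowski space and the hyperbolic space -/

/-- The Lorentzian inner product on `ℝ^{m+1}`; the last coordinate is the timelike one. -/
def lorentz {m : ℕ} (x y : Fin (m + 1) → ℝ) : ℝ :=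
  -(x (Fin.last m) * y (Fin.last m)) + ∑ k : Fin m, x k.castSucc * y k.castSucc

/-- The matrix of the flat Lorentzian metric of `ℝ^{m+1}_1`. -/
def minkowskiMetric (m : ℕ) : (Fin (m + 1) → ℝ) → Matrix (Fin (m + 1)) (Fin (m + 1)) ℝ :=
  fun _ => Matrix.of fun i j => lorentz (Pi.single i 1) (Pi.single j 1)

/-- The timelike cone `U^{m+1}` in `ℝ^{m+1}_1`. -/
def timelikeCone (m : ℕ) : Set (Fin (m + 1) → ℝ) := {x | lorentz x x < 0}

/-- The hyperbolic space `H^m = {x | ⟨x, x⟩_L = -1}` in `ℝ^{m+1}_1`, with both of its sheets. -/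
def hyperbolicSpace (m : ℕ) : Set (Fin (m + 1) → ℝ) := {x | lorentz x x = -1}

/-- The radial projection `x ↦ x / √(-⟨x, x⟩_L)`, from the timelike cone to hyperbolic space. -/
def radialProj {m : ℕ} (x : Fin (m + 1) → ℝ) : Fin (m + 1) → ℝ :=
  (√(-lorentz x x))⁻¹ • x

/-- For `ε = 1` and `ε = -1` the global parametrization `y ↦ (y, ε √(1 + |y|²))` of the upper and
of the lower sheet of `H^m` by `ℝᵐ`; the inverse of a global chart of that sheet. -/
def sheet {m : ℕ} (ε : ℝ) (y : Fin m → ℝ) : Fin (m + 1) → ℝ :=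
  Fin.snoc (α := fun _ => ℝ) y (ε * √(1 + ∑ k, y k ^ 2))

/-- The Riemannian metric of `H^m`, i.e. the one induced from `⟨·, ·⟩_L`, in the coordinates
`sheet ε`: `g_ij = ⟨∂ᵢ(sheet ε), ∂ⱼ(sheet ε)⟩_L`. -/
def hyperbolicMetric (m : ℕ) (ε : ℝ) : (Fin m → ℝ) → Matrix (Fin m) (Fin m) ℝ :=
  fun y => Matrix.of fun i j => lorentz (pderiv i (sheet ε) y) (pderiv j (sheet ε) y)

/-- `Φ` is a harmonic morphism from the open subset `A` of the Riemannian manifold `H^m` to `ℂ`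
(tested in the two global charts of the two sheets). Only the values of `Φ` on `A` matter. -/
def IsHarmonicMorphismOnHyperbolic {m : ℕ} (Φ : (Fin (m + 1) → ℝ) → ℂ)
    (A : Set (Fin (m + 1) → ℝ)) : Prop :=
  A ⊆ hyperbolicSpace m ∧
    ∀ ε : ℝ, ε = 1 ∨ ε = -1 →
      IsHarmonicMorphismOn (hyperbolicMetric m ε) (Φ ∘ sheet ε) (sheet ε ⁻¹' A)

/-! ### The maps -/

/-- The general complex-valued harmonic quadratic form on `ℝ³`. -/
def quad (a₁ a₂ b₁ b₂ b₃ : ℂ) (x : Fin 3 → ℝ) : ℂ :=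
  a₁ * ((x 0 : ℂ) ^ 2 - (x 1 : ℂ) ^ 2) + a₂ * ((x 1 : ℂ) ^ 2 - (x 2 : ℂ) ^ 2)
    + b₁ * (x 0 * x 1) + b₂ * (x 0 * x 2) + b₃ * (x 1 * x 2)

/-- The first three coordinates `(x₁, x₂, x₃)` of a point of `ℝ^{2n+3}`. -/
def firstThree {n : ℕ} (x : Fin (2 * n + 2 + 1) → ℝ) : Fin 3 → ℝ :=
  fun i => x ⟨i, by omega⟩

/-- The substitutions `z_k = x_{2k+2} + i x_{2k+3}` for `k < n` and `z_n = x_{2n+2} - x_{2n+3}`.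
In Lean the indices of `x` and of `z` start at `0` instead of `1`. -/
def zCoord {n : ℕ} (x : Fin (2 * n + 2 + 1) → ℝ) (k : Fin n) : ℂ :=
  if (k : ℕ) + 1 < n then
    (x ⟨2 * k + 3, by omega⟩ : ℂ) + Complex.I * (x ⟨2 * k + 4, by omega⟩ : ℂ)
  else
    (x ⟨2 * k + 3, by omega⟩ : ℂ) - (x ⟨2 * k + 4, by omega⟩ : ℂ)

/-- The map `(p^{d/2} + P(z)) / Q(z)`. The complex power is the principal one: for even `d` it is
the ordinary power with exponent `d/2`, for odd `d` it is `(√p)^d` with the standard root. -/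
def phiHat {n : ℕ} (d : ℕ) (p : (Fin 3 → ℝ) → ℂ) (P Q : MvPolynomial (Fin n) ℂ)
    (x : Fin (2 * n + 2 + 1) → ℝ) : ℂ :=
  (p (firstThree x) ^ ((d : ℂ) / 2) + MvPolynomial.eval (zCoord x) P) /
    MvPolynomial.eval (zCoord x) Q

/-- The domain of `phiHat`: the points of the timelike cone where `Q(z) ≠ 0` and, for odd `d`,
where moreover `p` takes its value outside `(-∞, 0]`. -/
def phiHatDomain {n : ℕ} (d : ℕ) (p : (Fin 3 → ℝ) → ℂ) (Q : MvPolynomial (Fin n) ℂ) :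
    Set (Fin (2 * n + 2 + 1) → ℝ) :=
  {x | x ∈ timelikeCone (2 * n + 2) ∧ MvPolynomial.eval (zCoord x) Q ≠ 0 ∧
    (Odd d → p (firstThree x) ∈ Complex.slitPlane)}

end HarmonicMorphism

end

open HarmonicMorphism

/-!
In a local frame the Laplacian of `g ∘ ψ`, with `g` holomorphic, is a combination of the tension
field of `ψ` and of the products `κ(ψ_a, ψ_b)`. Hence holomorphic functions of a family of
functions which are harmonic and pairwise (also with themselves) `κ`-orthogonal are harmonic, and
since every harmonic function on a disc is the real part of a holomorphic one, such functions are
harmonic morphisms. On `ℝ^{2n+3}_1` the functions `p` and `z_1, …, z_n` are such a family: `z_k`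
is linear with an isotropic gradient, and `p` lives on coordinates that the `z_k` do not involve.

For the descent to the unit hyperboloid, with position vector `σ`, one computes
`Δ_H (f ∘ σ) = (□ f + D² f (σ, σ) + m D f (σ)) ∘ σ`, and the last two terms vanish when `f` is
constant along rays.
-/

noncomputable section

namespace HarmonicMorphism

open Topology Filter

section SecondDerivatives

variable {𝕜 : Type*} [NontriviallyNormedField 𝕜] {E F : Type*}
  [NormedAddCommGroup E] [NormedSpace 𝕜 E] [NormedAddCommGroup F] [NormedSpace 𝕜 F]

theorem differentiableAt_fderiv_of_contDiffAt_two {f : E → F} {x : E} (hf : ContDiffAt 𝕜 2 f x) :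
    DifferentiableAt 𝕜 (fderiv 𝕜 f) x :=
  (hf.fderiv_right (m := 1) le_rfl).differentiableAt one_ne_zero

theorem eventually_differentiableAt_of_contDiffAt_two {f : E → F} {x : E}
    (hf : ContDiffAt 𝕜 2 f x) : ∀ᶠ y in 𝓝 x, DifferentiableAt 𝕜 f y :=
  (hf.eventually (by simp)).mono fun _ hy => hy.differentiableAt two_ne_zero

end SecondDerivatives

section Bilinear

variable {𝕜 ι F : Type*} [NontriviallyNormedField 𝕜] [Fintype ι] [DecidableEq ι]
  [NormedAddCommGroup F] [NormedSpace 𝕜 F]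

theorem bilinear_apply_eq_sum
    (B : (ι → 𝕜) →L[𝕜] (ι → 𝕜) →L[𝕜] F) (v w : ι → 𝕜) :
    B v w = ∑ a, ∑ b, (v a * w b) • B (Pi.single a 1) (Pi.single b 1) := by
  conv_lhs => rw [pi_eq_sum_univ' v, pi_eq_sum_univ' w]
  simp only [map_sum, map_smul, sum_apply, smul_apply,
    Finset.smul_sum, smul_smul]
  rw [Finset.sum_comm]
  simp only [mul_comm]

end Bilinear

section RadialDerivatives

variable {E F : Type*} [NormedAddCommGroup E] [NormedSpace ℝ E]
  [NormedAddCommGroup F] [NormedSpace ℝ F] {f : E → F} {x : E}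

theorem fderiv_apply_self_of_eventually_smul_eq (hf : DifferentiableAt ℝ f x)
    (h : ∀ᶠ r : ℝ in 𝓝 1, f (r • x) = f x) : fderiv ℝ f x x = 0 := by
  have hray : HasDerivAt (fun r : ℝ => r • x) x 1 := by
    simpa using (hasDerivAt_id (1 : ℝ)).smul_const x
  have hf' : HasFDerivAt f (fderiv ℝ f x) ((1 : ℝ) • x) := by simpa using hf.hasFDerivAt
  exact (hf'.comp_hasDerivAt (1 : ℝ) hray).unique
    ((hasDerivAt_const (1 : ℝ) (f x)).congr_of_eventuallyEq h)

theorem fderiv_fderiv_apply_self_of_eventually_smul_eq (hf : ContDiffAt ℝ 2 f x)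
    (h : ∀ᶠ y in 𝓝 x, ∀ᶠ r : ℝ in 𝓝 1, f (r • y) = f y) :
    fderiv ℝ (fderiv ℝ f) x x x = 0 := by
  have hzero : (fun y => fderiv ℝ f y y) =ᶠ[𝓝 x] fun _ => 0 := by
    filter_upwards [h, eventually_differentiableAt_of_contDiffAt_two hf] with y hy hfy
    exact fderiv_apply_self_of_eventually_smul_eq hfy hy
  have hderiv := ((differentiableAt_fderiv_of_contDiffAt_two hf).hasFDerivAt.clm_apply
    (hasFDerivAt_id x)).unique ((hasFDerivAt_const 0 x).congr_of_eventuallyEq hzero)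
  simpa [show fderiv ℝ f x x = 0 from hzero.eq_of_nhds] using congr($hderiv x)

end RadialDerivatives

section PartialDerivatives

variable {m : ℕ} {F : Type*} [NormedAddCommGroup F] [NormedSpace ℝ F] {x : Fin m → ℝ}

theorem differentiableAt_pderiv {u : (Fin m → ℝ) → F} (hu : ContDiffAt ℝ 2 u x) (i : Fin m) :
    DifferentiableAt ℝ (pderiv i u) x :=
  (differentiableAt_fderiv_of_contDiffAt_two hu).clm_apply (differentiableAt_const _)

theorem pderiv_pi {ι : Type*} [Fintype ι] {A : ι → Type*} [∀ k, NormedAddCommGroup (A k)]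
    [∀ k, NormedSpace ℝ (A k)] {ψ : (Fin m → ℝ) → ∀ k, A k} (hψ : DifferentiableAt ℝ ψ x)
    (i : Fin m) (k : ι) : pderiv i ψ x k = pderiv i (fun y => ψ y k) x := by
  rw [pderiv, pderiv, fderiv_apply hψ]
  rfl

theorem pderiv_coord (i j : Fin m) :
    pderiv i (fun y : Fin m → ℝ => y j) x = (Pi.single i 1 : Fin m → ℝ) j := by
  rw [pderiv, (hasFDerivAt_apply (𝕜 := ℝ) j x).fderiv, ContinuousLinearMap.proj_apply]

theorem pderiv_mul {A : Type*} [NormedRing A] [NormedAlgebra ℝ A] {f g : (Fin m → ℝ) → A}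
    (hf : DifferentiableAt ℝ f x) (hg : DifferentiableAt ℝ g x) (i : Fin m) :
    pderiv i (fun y => f y * g y) x = f x * pderiv i g x + pderiv i f x * g x := by
  rw [pderiv, fderiv_fun_mul' hf hg]
  rfl

theorem fderiv_apply_eq_sum_pderiv (u : (Fin m → ℝ) → F) (v : Fin m → ℝ) :
    fderiv ℝ u x v = ∑ i, v i • pderiv i u x := by
  conv_lhs => rw [pi_eq_sum_univ' v]
  simp only [map_sum, map_smul, pderiv]

theorem pderiv_pderiv {u : (Fin m → ℝ) → F} (hu : ContDiffAt ℝ 2 u x) (i j : Fin m) :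
    pderiv i (pderiv j u) x = fderiv ℝ (fderiv ℝ u) x (Pi.single i 1) (Pi.single j 1) := by
  have hclm := (differentiableAt_fderiv_of_contDiffAt_two hu).hasFDerivAt.clm_apply
    (hasFDerivAt_const (Pi.single j 1 : Fin m → ℝ) x)
  rw [pderiv, show pderiv j u = fun y => fderiv ℝ u y (Pi.single j 1) from rfl, hclm.fderiv]
  simp

variable {𝕜 : Type*} [NontriviallyNormedField 𝕜] [NormedAlgebra ℝ 𝕜]
  {E : Type*} [NormedAddCommGroup E] [NormedSpace ℝ E] [NormedSpace 𝕜 E] [IsScalarTower ℝ 𝕜 E]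
  [NormedSpace 𝕜 F] [IsScalarTower ℝ 𝕜 F] {g : E → F} {u : (Fin m → ℝ) → E}

theorem pderiv_comp (hg : DifferentiableAt 𝕜 g (u x)) (hu : DifferentiableAt ℝ u x) (i : Fin m) :
    pderiv i (g ∘ u) x = fderiv 𝕜 g (u x) (pderiv i u x) := by
  rw [pderiv, ((hg.hasFDerivAt.restrictScalars ℝ).comp x hu.hasFDerivAt).fderiv]
  rfl

theorem pderiv_pderiv_comp (hg : ContDiffAt 𝕜 2 g (u x)) (hu : ContDiffAt ℝ 2 u x) (i j : Fin m) :
    pderiv i (pderiv j (g ∘ u)) x =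
      fderiv 𝕜 (fderiv 𝕜 g) (u x) (pderiv i u x) (pderiv j u x) +
        fderiv 𝕜 g (u x) (pderiv i (pderiv j u) x) := by
  have hux := hu.differentiableAt two_ne_zero
  have hfirst : pderiv j (g ∘ u) =ᶠ[𝓝 x] fun y => fderiv 𝕜 g (u y) (pderiv j u y) := by
    filter_upwards [eventually_differentiableAt_of_contDiffAt_two hu,
      hu.continuousAt.eventually (eventually_differentiableAt_of_contDiffAt_two hg)]
      with y huy hgy
    exact pderiv_comp hgy huy j
  have hDg : HasFDerivAt (fun y => (fderiv 𝕜 g (u y)).restrictScalars ℝ)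
      (((ContinuousLinearMap.restrictScalarsL 𝕜 E F ℝ ℝ).comp
        ((fderiv 𝕜 (fderiv 𝕜 g) (u x)).restrictScalars ℝ)).comp (fderiv ℝ u x)) x :=
    (ContinuousLinearMap.restrictScalarsL 𝕜 E F ℝ ℝ).hasFDerivAt.comp x
      (((differentiableAt_fderiv_of_contDiffAt_two hg).hasFDerivAt.restrictScalars ℝ).comp x
        hux.hasFDerivAt)
  have hsecond := hDg.clm_apply (differentiableAt_pderiv hu j).hasFDerivAt
  rw [pderiv, (hsecond.congr_of_eventuallyEq hfirst).fderiv, add_comm]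
  rfl

end PartialDerivatives

section MatrixDerivatives

variable {ι E : Type*} [Fintype ι] [DecidableEq ι] [NormedAddCommGroup E] [NormedSpace ℝ E]
  {M : E → Matrix ι ι ℝ} {x : E}

theorem differentiableAt_det (hM : ∀ i j, DifferentiableAt ℝ (fun y => M y i j) x) :
    DifferentiableAt ℝ (fun y => (M y).det) x := by
  simp only [Matrix.det_apply']
  exact DifferentiableAt.fun_sum fun σ _ =>
    (HasFDerivAt.finsetProd fun i _ => (hM (σ i) i).hasFDerivAt).differentiableAt.const_mul _

theorem differentiableAt_adjugate (hM : ∀ i j, DifferentiableAt ℝ (fun y => M y i j) x) (i j : ι) :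
    DifferentiableAt ℝ (fun y => (M y).adjugate i j) x := by
  simp only [Matrix.adjugate_apply]
  refine differentiableAt_det fun k l => ?_
  by_cases hk : k = j
  · simp [hk]
  · simpa [hk] using hM k l

theorem differentiableAt_matrix_inv (hM : ∀ i j, DifferentiableAt ℝ (fun y => M y i j) x)
    (hdet : (M x).det ≠ 0) (i j : ι) : DifferentiableAt ℝ (fun y => (M y)⁻¹ i j) x := by
  simp only [Matrix.inv_def, Ring.inverse_eq_inv', Matrix.smul_apply, smul_eq_mul]
  exact ((differentiableAt_det hM).inv hdet).mul (differentiableAt_adjugate hM i j)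

theorem differentiableAt_sqrt_abs_det (hM : ∀ i j, DifferentiableAt ℝ (fun y => M y i j) x)
    (hdet : (M x).det ≠ 0) : DifferentiableAt ℝ (fun y => √|(M y).det|) x :=
  ((differentiableAt_det hM).abs hdet).sqrt (abs_ne_zero.2 hdet)

end MatrixDerivatives

section Metrics

variable {m : ℕ} {F : Type*} [NormedAddCommGroup F] [NormedSpace ℝ F]
  {G : (Fin m → ℝ) → Matrix (Fin m) (Fin m) ℝ} {x : Fin m → ℝ}

/-- The tension field of a map into a normed space: the Laplace-Beltrami operator applied to
vector-valued maps, written in non-divergence form. The first-order coefficients are the Laplacians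
of the coordinate functions, which for a smooth metric are `-g^{ij} Γᵏᵢⱼ`. -/
def tensionField (G : (Fin m → ℝ) → Matrix (Fin m) (Fin m) ℝ) (u : (Fin m → ℝ) → F)
    (x : Fin m → ℝ) : F :=
  ∑ i, ∑ j, (G x)⁻¹ i j • pderiv i (pderiv j u) x +
    ∑ j, laplaceBeltrami G (fun y => y j) x • pderiv j u x

/-- The conformality operator `κ(φ, ψ) = ∑ᵢⱼ g^{ij} ∂ᵢφ ∂ⱼψ` of a semi-Riemannian metric, for maps
with values in an `ℝ`-algebra. -/
def conformality {A : Type*} [NormedRing A] [NormedAlgebra ℝ A]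
    (G : (Fin m → ℝ) → Matrix (Fin m) (Fin m) ℝ) (φ ψ : (Fin m → ℝ) → A) (x : Fin m → ℝ) : A :=
  ∑ i, ∑ j, (G x)⁻¹ i j • (pderiv i φ x * pderiv j ψ x)

theorem laplaceBeltrami_congr {f g : (Fin m → ℝ) → ℝ} (h : f =ᶠ[𝓝 x] g) :
    laplaceBeltrami G f x = laplaceBeltrami G g x := by
  have hflux (i : Fin m) : (fun y => √|(G y).det| * ∑ j, (G y)⁻¹ i j * pderiv j f y) =ᶠ[𝓝 x]
      fun y => √|(G y).det| * ∑ j, (G y)⁻¹ i j * pderiv j g y := by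
    filter_upwards [h.fderiv (𝕜 := ℝ)] with y hy
    simp only [pderiv, hy]
  rw [laplaceBeltrami, laplaceBeltrami]
  simp only [pderiv] at hflux ⊢
  simp only [(hflux _).fderiv_eq]

theorem laplaceBeltrami_coord (G : (Fin m → ℝ) → Matrix (Fin m) (Fin m) ℝ) (x : Fin m → ℝ)
    (j : Fin m) : laplaceBeltrami G (fun y => y j) x =
      (√|(G x).det|)⁻¹ * ∑ i, pderiv i (fun y => √|(G y).det| * (G y)⁻¹ i j) x := by
  simp [laplaceBeltrami, pderiv_coord, Pi.single_apply]

theorem laplaceBeltrami_eq_tensionField (hG : ∀ i j, DifferentiableAt ℝ (fun y => G y i j) x)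
    (hdet : (G x).det ≠ 0) {f : (Fin m → ℝ) → ℝ} (hf : ContDiffAt ℝ 2 f x) :
    laplaceBeltrami G f x = tensionField G f x := by
  have hcoeff (i j : Fin m) : DifferentiableAt ℝ (fun y => √|(G y).det| * (G y)⁻¹ i j) x :=
    (differentiableAt_sqrt_abs_det hG hdet).mul (differentiableAt_matrix_inv hG hdet i j)
  have hflux (i : Fin m) : pderiv i (fun y => √|(G y).det| * ∑ j, (G y)⁻¹ i j * pderiv j f y) x =
      ∑ j, (√|(G x).det| * (G x)⁻¹ i j * pderiv i (pderiv j f) x +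
        pderiv i (fun y => √|(G y).det| * (G y)⁻¹ i j) x * pderiv j f x) := by
    simp only [Finset.mul_sum, ← mul_assoc]
    rw [pderiv, fderiv_fun_sum fun j _ => (hcoeff i j).fun_mul (differentiableAt_pderiv hf j),
      sum_apply]
    exact Finset.sum_congr rfl fun j _ => pderiv_mul (hcoeff i j) (differentiableAt_pderiv hf j) i
  have hweight : √|(G x).det| ≠ 0 := (Real.sqrt_pos.2 (abs_pos.2 hdet)).ne'
  simp only [laplaceBeltrami, hflux, Finset.sum_add_distrib, mul_add]
  rw [tensionField]
  simp only [laplaceBeltrami_coord, smul_eq_mul]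
  congr 1
  · simp only [Finset.mul_sum, ← mul_assoc, inv_mul_cancel₀ hweight, one_mul]
  · rw [Finset.sum_comm, Finset.mul_sum]
    refine Finset.sum_congr rfl fun j _ => ?_
    rw [← Finset.sum_mul, mul_assoc]

section ChainRule

variable {𝕜 : Type*} [NontriviallyNormedField 𝕜] [NormedAlgebra ℝ 𝕜]

theorem tensionField_comp {E : Type*} [NormedAddCommGroup E] [NormedSpace ℝ E] [NormedSpace 𝕜 E]
    [IsScalarTower ℝ 𝕜 E] [NormedSpace 𝕜 F] [IsScalarTower ℝ 𝕜 F] {g : E → F}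
    {u : (Fin m → ℝ) → E} (hg : ContDiffAt 𝕜 2 g (u x)) (hu : ContDiffAt ℝ 2 u x) :
    tensionField G (g ∘ u) x =
      ∑ i, ∑ j, (G x)⁻¹ i j • fderiv 𝕜 (fderiv 𝕜 g) (u x) (pderiv i u x) (pderiv j u x) +
        fderiv 𝕜 g (u x) (tensionField G u x) := by
  simp only [tensionField, pderiv_pderiv_comp hg hu, smul_add, Finset.sum_add_distrib, map_add,
    map_sum, pderiv_comp (hg.differentiableAt two_ne_zero) (hu.differentiableAt two_ne_zero),
    ContinuousLinearMap.map_smul_of_tower]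
  abel

theorem tensionField_continuousLinearMap_comp {E : Type*} [NormedAddCommGroup E] [NormedSpace ℝ E]
    (L : E →L[ℝ] F) {u : (Fin m → ℝ) → E} (hu : ContDiffAt ℝ 2 u x) :
    tensionField G (L ∘ u) x = L (tensionField G u x) := by
  have hL : fderiv ℝ (fderiv ℝ L) = 0 := by
    ext1 z
    rw [show fderiv ℝ L = fun _ => L from funext fun _ => L.fderiv]
    simp
  simp [tensionField_comp (𝕜 := ℝ) L.contDiff.contDiffAt hu, hL]

theorem tensionField_pi {ι : Type*} [Fintype ι] {A : ι → Type*} [∀ a, NormedAddCommGroup (A a)]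
    [∀ a, NormedSpace ℝ (A a)] {ψ : (Fin m → ℝ) → ∀ a, A a} (hψ : ContDiffAt ℝ 2 ψ x) (a : ι) :
    tensionField G ψ x a = tensionField G (fun y => ψ y a) x :=
  (tensionField_continuousLinearMap_comp (ContinuousLinearMap.proj a) hψ).symm

theorem tensionField_comp_pi {ι : Type*} [Fintype ι] [DecidableEq ι] [NormedSpace 𝕜 F]
    [IsScalarTower ℝ 𝕜 F] {g : (ι → 𝕜) → F} {ψ : (Fin m → ℝ) → ι → 𝕜}
    (hg : ContDiffAt 𝕜 2 g (ψ x)) (hψ : ContDiffAt ℝ 2 ψ x) :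
    tensionField G (g ∘ ψ) x =
      ∑ a, ∑ b, conformality G (fun y => ψ y a) (fun y => ψ y b) x •
          fderiv 𝕜 (fderiv 𝕜 g) (ψ x) (Pi.single a 1) (Pi.single b 1) +
        fderiv 𝕜 g (ψ x) (tensionField G ψ x) := by
  rw [tensionField_comp hg hψ]
  congr 1
  simp only [bilinear_apply_eq_sum (fderiv 𝕜 (fderiv 𝕜 g) (ψ x)) (pderiv _ ψ x),
    pderiv_pi (hψ.differentiableAt two_ne_zero), conformality, Finset.sum_smul, Finset.smul_sum,
    smul_assoc]
  calc
    _ = ∑ i, ∑ a, ∑ j, ∑ b, _ := Finset.sum_congr rfl fun i _ => Finset.sum_comm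
    _ = ∑ a, ∑ i, ∑ b, ∑ j, _ := by
      rw [Finset.sum_comm]
      exact Finset.sum_congr rfl fun a _ => Finset.sum_congr rfl fun i _ => Finset.sum_comm
    _ = _ := Finset.sum_congr rfl fun a _ => Finset.sum_comm

end ChainRule

end Metrics

section OrthogonalHarmonicFamilies

variable {m : ℕ} {ι : Type*} [Fintype ι] {G : (Fin m → ℝ) → Matrix (Fin m) (Fin m) ℝ}
  {ψ : (Fin m → ℝ) → ι → ℂ}

/-- The components of `ψ` form an orthogonal family of harmonic morphisms at `x`: they are harmonic
and all their conformality operators `κ(ψ_a, ψ_b)`, including those with `a = b`, vanish. -/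
structure IsOrthogonalHarmonicFamilyAt (G : (Fin m → ℝ) → Matrix (Fin m) (Fin m) ℝ)
    (ψ : (Fin m → ℝ) → ι → ℂ) (x : Fin m → ℝ) : Prop where
  contDiffAt : ContDiffAt ℝ ∞ ψ x
  tensionField_eq_zero : tensionField G ψ x = 0
  conformality_eq_zero : ∀ a b, conformality G (fun y => ψ y a) (fun y => ψ y b) x = 0

variable {x : Fin m → ℝ} {F : (ι → ℂ) → ℂ}

theorem IsOrthogonalHarmonicFamilyAt.tensionField_comp_eq_zero
    (hψ : IsOrthogonalHarmonicFamilyAt G ψ x) (hF : ContDiffAt ℂ 2 F (ψ x)) :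
    tensionField G (F ∘ ψ) x = 0 := by
  classical
  simp [tensionField_comp_pi hF (hψ.contDiffAt.of_le ENat.LEInfty.out), hψ.tensionField_eq_zero,
    hψ.conformality_eq_zero]

theorem laplaceBeltrami_re (hG : ∀ i j, DifferentiableAt ℝ (fun y => G y i j) x)
    (hdet : (G x).det ≠ 0) {φ : (Fin m → ℝ) → ℂ} (hφ : ContDiffAt ℝ 2 φ x) :
    laplaceBeltrami G (fun y => (φ y).re) x = (tensionField G φ x).re :=
  (laplaceBeltrami_eq_tensionField hG hdet (Complex.reCLM.contDiff.contDiffAt.comp x hφ)).trans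
    (tensionField_continuousLinearMap_comp Complex.reCLM hφ)

theorem IsOrthogonalHarmonicFamilyAt.laplaceBeltrami_comp_eq_zero
    (hψ : IsOrthogonalHarmonicFamilyAt G ψ x)
    (hG : ∀ i j, DifferentiableAt ℝ (fun y => G y i j) x) (hdet : (G x).det ≠ 0)
    (hF : AnalyticAt ℂ F (ψ x)) {f : ℂ → ℝ} {W : Set ℂ} (hW : W ∈ 𝓝 (F (ψ x)))
    (hf : InnerProductSpace.HarmonicOnNhd f W) : laplaceBeltrami G (f ∘ F ∘ ψ) x = 0 := by
  obtain ⟨R, hR, hball⟩ := Metric.mem_nhds_iff.1 hW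
  obtain ⟨g, hg, hgf⟩ := (hf.mono hball).exists_analyticOnNhd_ball_re_eq
  have hFψ : ContinuousAt (F ∘ ψ) x := hF.continuousAt.comp hψ.contDiffAt.continuousAt
  have hfg : f ∘ F ∘ ψ =ᶠ[𝓝 x] fun y => (((g ∘ F) ∘ ψ) y).re := by
    filter_upwards [hFψ (Metric.ball_mem_nhds _ hR)] with y hy
    exact (hgf hy).symm
  have hgF : ContDiffAt ℂ 2 (g ∘ F) (ψ x) :=
    (AnalyticAt.comp (hg _ (Metric.mem_ball_self hR)) hF).contDiffAt
  rw [laplaceBeltrami_congr hfg, laplaceBeltrami_re hG hdet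
    ((hgF.restrict_scalars ℝ).comp x (hψ.contDiffAt.of_le ENat.LEInfty.out)),
    hψ.tensionField_comp_eq_zero hgF, Complex.zero_re]

theorem isHarmonicMorphismOn_comp_of_isOrthogonalHarmonicFamilyAt {Ω : Set (Fin m → ℝ)}
    (hΩ : IsOpen Ω) (hG : ∀ x ∈ Ω, ∀ i j, DifferentiableAt ℝ (fun y => G y i j) x)
    (hdet : ∀ x ∈ Ω, (G x).det ≠ 0) (hψ : ∀ x ∈ Ω, IsOrthogonalHarmonicFamilyAt G ψ x)
    (hF : ∀ x ∈ Ω, AnalyticAt ℂ F (ψ x)) : IsHarmonicMorphismOn G (F ∘ ψ) Ω := by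
  have hFψ (x) (hx : x ∈ Ω) : ContDiffAt ℝ ∞ (F ∘ ψ) x :=
    ((hF x hx).contDiffAt.restrict_scalars ℝ).comp x (hψ x hx).contDiffAt
  refine ⟨hΩ, fun x hx => (hFψ x hx).contDiffWithinAt, fun W f hW _ hf => ⟨?_, ?_⟩⟩
  · rintro x ⟨hx, hxW⟩
    exact ((hf _ hxW).1.comp x ((hFψ x hx).of_le ENat.LEInfty.out)).contDiffWithinAt
  · rintro x ⟨hx, hxW⟩
    exact (hψ x hx).laplaceBeltrami_comp_eq_zero (hG x hx) (hdet x hx) (hF x hx)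
      (hW.mem_nhds hxW) hf

end OrthogonalHarmonicFamilies

section Minkowski

/-- The signs `⟨eᵢ, eᵢ⟩_L` of the standard basis of Minkowski space. -/
def lorentzSign (m : ℕ) : Fin (m + 1) → ℝ := Fin.snoc (α := fun _ => ℝ) (fun _ => 1) (-1)

@[simp] theorem lorentzSign_last (m : ℕ) : lorentzSign m (Fin.last m) = -1 := by
  rw [lorentzSign, Fin.snoc_last]

@[simp] theorem lorentzSign_castSucc {m : ℕ} (i : Fin m) : lorentzSign m i.castSucc = 1 := by
  rw [lorentzSign, Fin.snoc_castSucc]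

theorem lorentzSign_mul_self {m : ℕ} (i : Fin (m + 1)) : lorentzSign m i * lorentzSign m i = 1 := by
  cases i using Fin.lastCases <;> simp

variable {m : ℕ} {x : Fin (m + 1) → ℝ}

theorem minkowskiMetric_eq_diagonal (m : ℕ) :
    minkowskiMetric m = fun _ => Matrix.diagonal (lorentzSign m) := by
  ext x i j
  cases i using Fin.lastCases <;> cases j using Fin.lastCases <;>
    simp [minkowskiMetric, lorentz, Matrix.diagonal_apply, Pi.single_apply, eq_comm]

theorem minkowskiMetric_inv (x : Fin (m + 1) → ℝ) :
    (minkowskiMetric m x)⁻¹ = Matrix.diagonal (lorentzSign m) := by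
  rw [minkowskiMetric_eq_diagonal]
  refine Matrix.inv_eq_right_inv ?_
  simp only [Matrix.diagonal_mul_diagonal, lorentzSign_mul_self, Matrix.diagonal_one]

theorem det_minkowskiMetric (x : Fin (m + 1) → ℝ) : (minkowskiMetric m x).det = -1 := by
  simp [minkowskiMetric_eq_diagonal, Matrix.det_diagonal, Fin.prod_univ_castSucc]

theorem det_minkowskiMetric_ne_zero (x : Fin (m + 1) → ℝ) : (minkowskiMetric m x).det ≠ 0 := by
  rw [det_minkowskiMetric]
  exact neg_ne_zero.2 one_ne_zero

theorem differentiableAt_minkowskiMetric (i j : Fin (m + 1)) :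
    DifferentiableAt ℝ (fun y => minkowskiMetric m y i j) x := by
  simp only [minkowskiMetric_eq_diagonal, differentiableAt_const]

theorem laplaceBeltrami_minkowskiMetric_coord (j : Fin (m + 1)) :
    laplaceBeltrami (minkowskiMetric m) (fun y => y j) x = 0 := by
  simp [laplaceBeltrami_coord, minkowskiMetric_inv, det_minkowskiMetric, pderiv]

theorem tensionField_minkowskiMetric {F : Type*} [NormedAddCommGroup F] [NormedSpace ℝ F]
    (u : (Fin (m + 1) → ℝ) → F) (x : Fin (m + 1) → ℝ) :
    tensionField (minkowskiMetric m) u x = ∑ i, lorentzSign m i • pderiv i (pderiv i u) x := by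
  simp [tensionField, minkowskiMetric_inv, laplaceBeltrami_minkowskiMetric_coord,
    Matrix.diagonal_apply, ite_smul]

theorem conformality_minkowskiMetric {A : Type*} [NormedRing A] [NormedAlgebra ℝ A]
    (φ ψ : (Fin (m + 1) → ℝ) → A) (x : Fin (m + 1) → ℝ) :
    conformality (minkowskiMetric m) φ ψ x =
      ∑ i, lorentzSign m i • (pderiv i φ x * pderiv i ψ x) := by
  simp [conformality, minkowskiMetric_inv, Matrix.diagonal_apply, ite_smul]

theorem isHarmonicMorphismOn_minkowskiMetric_comp {ι : Type*} [Fintype ι]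
    {ψ : (Fin (m + 1) → ℝ) → ι → ℂ} {F : (ι → ℂ) → ℂ} {Ω : Set (Fin (m + 1) → ℝ)}
    (hΩ : IsOpen Ω) (hψ : ∀ x ∈ Ω, IsOrthogonalHarmonicFamilyAt (minkowskiMetric m) ψ x)
    (hF : ∀ x ∈ Ω, AnalyticAt ℂ F (ψ x)) :
    IsHarmonicMorphismOn (minkowskiMetric m) (F ∘ ψ) Ω :=
  isHarmonicMorphismOn_comp_of_isOrthogonalHarmonicFamilyAt hΩ
    (fun _ _ => differentiableAt_minkowskiMetric)
    (fun x _ => det_minkowskiMetric_ne_zero x) hψ hF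

end Minkowski

section Hyperbolic

variable {m : ℕ}

/-- The function `√(1 + |y|²)`, which is up to sign the timelike coordinate of the chart `sheet`. -/
def height (y : Fin m → ℝ) : ℝ := √(1 + ∑ k, y k ^ 2)

theorem height_pos (y : Fin m → ℝ) : 0 < height y := Real.sqrt_pos.2 (by positivity)

theorem height_sq (y : Fin m → ℝ) : height y ^ 2 = 1 + ∑ k, y k ^ 2 :=
  Real.sq_sqrt (by positivity)

theorem dotProduct_self_eq_height_sq_sub_one (y : Fin m → ℝ) : y ⬝ᵥ y = height y ^ 2 - 1 := by
  rw [height_sq, add_sub_cancel_left, dotProduct]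
  simp only [sq]

theorem contDiff_height {k : WithTop ℕ∞} : ContDiff ℝ k (height (m := m)) :=
  ContDiff.sqrt (by fun_prop) fun y => by positivity

theorem differentiable_height : Differentiable ℝ (height (m := m)) :=
  contDiff_height.differentiable one_ne_zero

theorem pderiv_height (i : Fin m) (y : Fin m → ℝ) : pderiv i height y = (height y)⁻¹ * y i := by
  have hsq : HasFDerivAt (fun y : Fin m → ℝ => 1 + ∑ k, y k ^ 2)
      (∑ k, (2 * y k) • (ContinuousLinearMap.proj k : (Fin m → ℝ) →L[ℝ] ℝ)) y := by
    refine (HasFDerivAt.fun_sum fun k _ => ?_).const_add 1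
    simpa using (hasFDerivAt_apply (𝕜 := ℝ) k y).pow 2
  have hsqrt : HasFDerivAt height ((1 / (2 * height y)) •
      ∑ k, (2 * y k) • (ContinuousLinearMap.proj k : (Fin m → ℝ) →L[ℝ] ℝ)) y :=
    hsq.sqrt (by positivity)
  rw [pderiv, hsqrt.fderiv]
  simp only [smul_apply, sum_apply, ContinuousLinearMap.proj_apply, smul_eq_mul, Pi.single_apply,
    mul_ite, mul_one, mul_zero, Finset.sum_ite_eq', Finset.mem_univ, if_true]
  field_simp

theorem pderiv_height_inv (i : Fin m) (y : Fin m → ℝ) :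
    pderiv i (fun y => (height y)⁻¹) y = -(height y)⁻¹ ^ 3 * y i := by
  have hinv : HasFDerivAt (fun y : Fin m → ℝ => (height y)⁻¹)
      (-(height y ^ 2)⁻¹ • fderiv ℝ height y) y :=
    (hasDerivAt_inv (height_pos y).ne').comp_hasFDerivAt y (differentiable_height y).hasFDerivAt
  rw [pderiv, hinv.fderiv, smul_apply, ← pderiv, pderiv_height, smul_eq_mul]
  ring

theorem sheet_castSucc (ε : ℝ) (y : Fin m → ℝ) (a : Fin m) : sheet ε y a.castSucc = y a := by
  rw [sheet, Fin.snoc_castSucc]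

theorem sheet_last (ε : ℝ) (y : Fin m → ℝ) : sheet ε y (Fin.last m) = ε * height y := by
  rw [sheet, Fin.snoc_last, height]

theorem contDiff_sheet {k : WithTop ℕ∞} (ε : ℝ) : ContDiff ℝ k (sheet (m := m) ε) := by
  refine contDiff_pi.2 fun a => ?_
  cases a using Fin.lastCases with
  | last => simpa only [sheet_last] using contDiff_const.mul contDiff_height
  | cast a => simpa only [sheet_castSucc] using contDiff_apply ℝ ℝ a

theorem pderiv_sheet_castSucc (ε : ℝ) (y : Fin m → ℝ) (i a : Fin m) :
    pderiv i (fun y => sheet ε y a.castSucc) y = (Pi.single i 1 : Fin m → ℝ) a := by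
  simp only [sheet_castSucc, pderiv_coord]

theorem pderiv_sheet_last (ε : ℝ) (y : Fin m → ℝ) (i : Fin m) :
    pderiv i (fun y => sheet ε y (Fin.last m)) y = ε * ((height y)⁻¹ * y i) := by
  simp only [sheet_last]
  rw [← pderiv_height, pderiv, fderiv_const_mul (differentiable_height y)]
  rfl

theorem hyperbolicMetric_eq {ε : ℝ} (hε : ε ^ 2 = 1) (y : Fin m → ℝ) :
    hyperbolicMetric m ε y = 1 - (height y ^ 2)⁻¹ • Matrix.vecMulVec y y := by
  ext i j
  have hsheet : DifferentiableAt ℝ (sheet ε) y := (contDiff_sheet ε).differentiable one_ne_zero y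
  have hdelta : ∑ k, (Pi.single i 1 : Fin m → ℝ) k * (Pi.single j 1 : Fin m → ℝ) k =
      (1 : Matrix (Fin m) (Fin m) ℝ) i j := by
    rw [Matrix.one_eq_pi_single]
    exact dotProduct_single_one _ j
  simp only [hyperbolicMetric, lorentz, Matrix.of_apply, pderiv_pi hsheet, pderiv_sheet_castSucc,
    pderiv_sheet_last, hdelta, Matrix.sub_apply, Matrix.smul_apply, Matrix.vecMulVec_apply,
    smul_eq_mul]
  linear_combination (-(height y)⁻¹ ^ 2 * y i * y j) * hε

theorem differentiableAt_hyperbolicMetric {ε : ℝ} (hε : ε ^ 2 = 1) (y : Fin m → ℝ) (i j : Fin m) :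
    DifferentiableAt ℝ (fun y => hyperbolicMetric m ε y i j) y := by
  have hinv : DifferentiableAt ℝ (fun y : Fin m → ℝ => (height y ^ 2)⁻¹) y :=
    ((differentiable_height y).pow 2).inv (pow_ne_zero 2 (height_pos y).ne')
  simp only [hyperbolicMetric_eq hε, Matrix.sub_apply, Matrix.smul_apply, Matrix.vecMulVec_apply,
    smul_eq_mul]
  fun_prop

theorem hyperbolicMetric_mul {ε : ℝ} (hε : ε ^ 2 = 1) (y : Fin m → ℝ) :
    hyperbolicMetric m ε y * (1 + Matrix.vecMulVec y y) = 1 := by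
  have hh := (height_pos y).ne'
  rw [hyperbolicMetric_eq hε, sub_mul, mul_add, mul_add, Matrix.smul_mul, Matrix.smul_mul,
    Matrix.vecMulVec_mul_vecMulVec, dotProduct_self_eq_height_sq_sub_one]
  ext i j
  simp only [Matrix.sub_apply, Matrix.add_apply, Matrix.smul_apply, Matrix.vecMulVec_apply, one_mul,
    mul_one, Pi.smul_apply, smul_eq_mul]
  field_simp
  ring

theorem hyperbolicMetric_inv {ε : ℝ} (hε : ε ^ 2 = 1) (y : Fin m → ℝ) :
    (hyperbolicMetric m ε y)⁻¹ = 1 + Matrix.vecMulVec y y :=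
  Matrix.inv_eq_right_inv (hyperbolicMetric_mul hε y)

theorem det_hyperbolicMetric {ε : ℝ} (hε : ε ^ 2 = 1) (y : Fin m → ℝ) :
    (hyperbolicMetric m ε y).det = (height y ^ 2)⁻¹ := by
  have hdet : (1 + Matrix.vecMulVec y y).det = height y ^ 2 := by
    rw [Matrix.vecMulVec_eq Unit, Matrix.det_one_add_replicateCol_mul_replicateRow,
      dotProduct_self_eq_height_sq_sub_one, add_sub_cancel]
  refine eq_inv_of_mul_eq_one_left ?_
  rw [← hdet, ← Matrix.det_mul, hyperbolicMetric_mul hε, Matrix.det_one]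

theorem det_hyperbolicMetric_ne_zero {ε : ℝ} (hε : ε ^ 2 = 1) (y : Fin m → ℝ) :
    (hyperbolicMetric m ε y).det ≠ 0 := by
  rw [det_hyperbolicMetric hε]
  exact inv_ne_zero (pow_ne_zero 2 (height_pos y).ne')

theorem sqrt_abs_det_hyperbolicMetric {ε : ℝ} (hε : ε ^ 2 = 1) (y : Fin m → ℝ) :
    √|(hyperbolicMetric m ε y).det| = (height y)⁻¹ := by
  rw [det_hyperbolicMetric hε, abs_of_nonneg (by positivity), Real.sqrt_inv,
    Real.sqrt_sq (height_pos y).le]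

theorem conformality_hyperbolicMetric {ε : ℝ} (hε : ε ^ 2 = 1) {A : Type*} [NormedRing A]
    [NormedAlgebra ℝ A] (φ ψ : (Fin m → ℝ) → A) (y : Fin m → ℝ) :
    conformality (hyperbolicMetric m ε) φ ψ y =
      ∑ i, pderiv i φ y * pderiv i ψ y + fderiv ℝ φ y y * fderiv ℝ ψ y y := by
  simp only [conformality, hyperbolicMetric_inv hε, Matrix.add_apply, Matrix.vecMulVec_apply,
    add_smul, Finset.sum_add_distrib, Matrix.one_apply, ite_smul, one_smul, zero_smul,
    Finset.sum_ite_eq, Finset.mem_univ, if_true, fderiv_apply_eq_sum_pderiv, Finset.sum_mul_sum,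
    smul_mul_smul_comm]

theorem fderiv_sheet_castSucc_apply_self (ε : ℝ) (y : Fin m → ℝ) (a : Fin m) :
    fderiv ℝ (fun y => sheet ε y a.castSucc) y y = y a := by
  simp [fderiv_apply_eq_sum_pderiv, pderiv_sheet_castSucc, Pi.single_apply]

theorem fderiv_sheet_last_apply_self (ε : ℝ) (y : Fin m → ℝ) :
    fderiv ℝ (fun y => sheet ε y (Fin.last m)) y y = ε * ((height y)⁻¹ * (height y ^ 2 - 1)) := by
  simp only [fderiv_apply_eq_sum_pderiv, pderiv_sheet_last, smul_eq_mul,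
    ← dotProduct_self_eq_height_sq_sub_one, dotProduct, Finset.mul_sum]
  exact Finset.sum_congr rfl fun _ _ => by ring

theorem conformality_sheet {ε : ℝ} (hε : ε ^ 2 = 1) (y : Fin m → ℝ) (a b : Fin (m + 1)) :
    conformality (hyperbolicMetric m ε) (fun y => sheet ε y a) (fun y => sheet ε y b) y =
      Matrix.diagonal (lorentzSign m) a b + sheet ε y a * sheet ε y b := by
  have hcancel : (height y)⁻¹ * height y = 1 := inv_mul_cancel₀ (height_pos y).ne'
  rw [conformality_hyperbolicMetric hε]
  cases a using Fin.lastCases <;> cases b using Fin.lastCases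
  case last.last =>
    have hgrad : ∑ i, ε * ((height y)⁻¹ * y i) * (ε * ((height y)⁻¹ * y i)) =
        (ε * (height y)⁻¹) ^ 2 * (height y ^ 2 - 1) := by
      rw [← dotProduct_self_eq_height_sq_sub_one, dotProduct, Finset.mul_sum]
      exact Finset.sum_congr rfl fun _ _ => by ring
    rw [fderiv_sheet_last_apply_self]
    simp only [pderiv_sheet_last, hgrad, Matrix.diagonal_apply_eq, lorentzSign_last]
    rw [sheet_last]
    linear_combination ε ^ 2 * (height y ^ 2 - 1) * ((height y)⁻¹ * height y + 1) * hcancel - hε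
  case last.cast b =>
    rw [fderiv_sheet_last_apply_self, fderiv_sheet_castSucc_apply_self,
      Matrix.diagonal_apply_ne _ (Fin.castSucc_lt_last b).ne']
    simp only [pderiv_sheet_last, pderiv_sheet_castSucc, Pi.single_apply, mul_ite, mul_one,
      mul_zero, Finset.sum_ite_eq, Finset.mem_univ, if_true]
    rw [sheet_last, sheet_castSucc]
    linear_combination ε * y b * height y * hcancel
  case cast.last a =>
    rw [fderiv_sheet_last_apply_self, fderiv_sheet_castSucc_apply_self,
      Matrix.diagonal_apply_ne _ (Fin.castSucc_lt_last a).ne]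
    simp only [pderiv_sheet_last, pderiv_sheet_castSucc, Pi.single_apply, ite_mul, one_mul,
      zero_mul, Finset.sum_ite_eq, Finset.mem_univ, if_true]
    rw [sheet_last, sheet_castSucc]
    linear_combination ε * y a * height y * hcancel
  case cast.cast a b =>
    rw [fderiv_sheet_castSucc_apply_self, fderiv_sheet_castSucc_apply_self]
    simp only [pderiv_sheet_castSucc]
    simp [sheet_castSucc, Pi.single_apply, Matrix.diagonal_apply]

theorem laplaceBeltrami_hyperbolicMetric_coord {ε : ℝ} (hε : ε ^ 2 = 1) (y : Fin m → ℝ)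
    (j : Fin m) : laplaceBeltrami (hyperbolicMetric m ε) (fun y => y j) y = m * y j := by
  have hflux (i : Fin m) : pderiv i (fun y => (height y)⁻¹ * (1 + Matrix.vecMulVec y y) i j) y =
      (height y)⁻¹ * (y j + y i * (Pi.single i 1 : Fin m → ℝ) j) -
        (height y)⁻¹ ^ 3 * (y i * (1 : Matrix (Fin m) (Fin m) ℝ) i j + y j * (y i * y i)) := by
    have hinv : DifferentiableAt ℝ (fun y : Fin m → ℝ => (height y)⁻¹) y :=
      (differentiable_height y).inv (height_pos y).ne'
    simp only [Matrix.add_apply, Matrix.vecMulVec_apply]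
    rw [pderiv_mul hinv (by fun_prop), pderiv_height_inv, pderiv, fderiv_const_add, ← pderiv,
      pderiv_mul (by fun_prop) (by fun_prop), pderiv_coord, pderiv_coord, Pi.single_eq_same]
    ring
  have hdiv : ∑ i, ((height y)⁻¹ * (y j + y i * (Pi.single i 1 : Fin m → ℝ) j) -
      (height y)⁻¹ ^ 3 * (y i * (1 : Matrix (Fin m) (Fin m) ℝ) i j + y j * (y i * y i))) =
      (height y)⁻¹ * (m * y j + y j) - (height y)⁻¹ ^ 3 * (y j + y j * (height y ^ 2 - 1)) := by
    rw [← dotProduct_self_eq_height_sq_sub_one, dotProduct, Finset.sum_sub_distrib,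
      ← Finset.mul_sum, ← Finset.mul_sum, Finset.sum_add_distrib, Finset.sum_add_distrib,
      ← Finset.mul_sum]
    simp [Pi.single_apply, Matrix.one_apply]
  have hh := (height_pos y).ne'
  rw [laplaceBeltrami_coord]
  simp only [hyperbolicMetric_inv hε, sqrt_abs_det_hyperbolicMetric hε, hflux, hdiv]
  field_simp
  ring

theorem laplaceBeltrami_hyperbolicMetric_height {ε : ℝ} (hε : ε ^ 2 = 1) (y : Fin m → ℝ) :
    laplaceBeltrami (hyperbolicMetric m ε) height y = m * height y := by
  have hflux (y : Fin m → ℝ) (i : Fin m) : (height y)⁻¹ *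
      ∑ j, (1 + Matrix.vecMulVec y y) i j * ((height y)⁻¹ * y j) = y i := by
    have hh : height y ≠ 0 := (height_pos y).ne'
    calc
      _ = (height y)⁻¹ ^ 2 * ((1 + Matrix.vecMulVec y y).mulVec y i) := by
        rw [Matrix.mulVec, dotProduct, Finset.mul_sum, Finset.mul_sum]
        exact Finset.sum_congr rfl fun _ _ => by ring
      _ = (height y)⁻¹ ^ 2 * (y i + y i * (height y ^ 2 - 1)) := by
        rw [Matrix.add_mulVec, Matrix.one_mulVec, Matrix.vecMulVec_mulVec,
          dotProduct_self_eq_height_sq_sub_one]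
        rfl
      _ = y i := by field_simp; ring
  simp only [laplaceBeltrami, hyperbolicMetric_inv hε, sqrt_abs_det_hyperbolicMetric hε,
    pderiv_height, hflux, pderiv_coord, Pi.single_eq_same, Finset.sum_const, Finset.card_univ,
    Fintype.card_fin, nsmul_eq_mul, mul_one, inv_inv]
  ring

theorem tensionField_sheet {ε : ℝ} (hε : ε ^ 2 = 1) (y : Fin m → ℝ) :
    tensionField (hyperbolicMetric m ε) (sheet ε) y = (m : ℝ) • sheet ε y := by
  have hlap {f : (Fin m → ℝ) → ℝ} (hf : ContDiff ℝ 2 f) :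
      tensionField (hyperbolicMetric m ε) f y = laplaceBeltrami (hyperbolicMetric m ε) f y :=
    (laplaceBeltrami_eq_tensionField (differentiableAt_hyperbolicMetric hε y)
      (det_hyperbolicMetric_ne_zero hε y) hf.contDiffAt).symm
  ext a
  rw [tensionField_pi (contDiff_sheet ε).contDiffAt, Pi.smul_apply, smul_eq_mul]
  cases a using Fin.lastCases with
  | last =>
    have hconst := tensionField_continuousLinearMap_comp (G := hyperbolicMetric m ε)
      (ε • ContinuousLinearMap.id ℝ ℝ) (x := y) contDiff_height.contDiffAt
    rw [hlap contDiff_height, laplaceBeltrami_hyperbolicMetric_height hε] at hconst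
    simp only [sheet_last]
    exact hconst.trans (mul_left_comm ε (m : ℝ) (height y))
  | cast a =>
    simp only [sheet_castSucc]
    rw [hlap (contDiff_apply ℝ ℝ a), laplaceBeltrami_hyperbolicMetric_coord hε]

theorem tensionField_hyperbolicMetric_comp_sheet {ε : ℝ} (hε : ε ^ 2 = 1) {F : Type*}
    [NormedAddCommGroup F] [NormedSpace ℝ F] {f : (Fin (m + 1) → ℝ) → F} {y : Fin m → ℝ}
    (hf : ContDiffAt ℝ 2 f (sheet ε y)) :
    tensionField (hyperbolicMetric m ε) (f ∘ sheet ε) y =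
      tensionField (minkowskiMetric m) f (sheet ε y) +
        fderiv ℝ (fderiv ℝ f) (sheet ε y) (sheet ε y) (sheet ε y) +
        (m : ℝ) • fderiv ℝ f (sheet ε y) (sheet ε y) := by
  rw [tensionField_comp_pi hf (contDiff_sheet ε).contDiffAt, tensionField_sheet hε, map_smul,
    bilinear_apply_eq_sum, tensionField_minkowskiMetric]
  simp only [conformality_sheet hε, add_smul, Finset.sum_add_distrib, Matrix.diagonal_apply,
    ite_smul, zero_smul, Finset.sum_ite_eq, Finset.mem_univ, if_true, pderiv_pderiv hf]

theorem laplaceBeltrami_hyperbolicMetric_comp_sheet {ε : ℝ} (hε : ε ^ 2 = 1)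
    {f : (Fin (m + 1) → ℝ) → ℝ} {y : Fin m → ℝ} (hf : ContDiffAt ℝ 2 f (sheet ε y))
    (hray : ∀ᶠ x in 𝓝 (sheet ε y), ∀ᶠ r : ℝ in 𝓝 1, f (r • x) = f x) :
    laplaceBeltrami (hyperbolicMetric m ε) (f ∘ sheet ε) y =
      laplaceBeltrami (minkowskiMetric m) f (sheet ε y) := by
  rw [laplaceBeltrami_eq_tensionField (differentiableAt_hyperbolicMetric hε y)
      (det_hyperbolicMetric_ne_zero hε y) (hf.comp y (contDiff_sheet ε).contDiffAt),
    laplaceBeltrami_eq_tensionField differentiableAt_minkowskiMetric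
      (det_minkowskiMetric_ne_zero _) hf,
    tensionField_hyperbolicMetric_comp_sheet hε hf,
    fderiv_fderiv_apply_self_of_eventually_smul_eq hf hray,
    fderiv_apply_self_of_eventually_smul_eq (hf.differentiableAt two_ne_zero) hray.self_of_nhds,
    smul_zero, add_zero, add_zero]

theorem sheet_mem_hyperbolicSpace {ε : ℝ} (hε : ε ^ 2 = 1) (y : Fin m → ℝ) :
    sheet ε y ∈ hyperbolicSpace m := by
  have hdot : ∑ k, y k * y k = height y ^ 2 - 1 := dotProduct_self_eq_height_sq_sub_one y
  simp only [hyperbolicSpace, Set.mem_ofPred_eq, lorentz, sheet_last, sheet_castSucc, hdot]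
  linear_combination -height y ^ 2 * hε

theorem isHarmonicMorphismOnHyperbolic_of_minkowski {V : Set (Fin (m + 1) → ℝ)}
    {φ : (Fin (m + 1) → ℝ) → ℂ} (hφ : IsHarmonicMorphismOn (minkowskiMetric m) φ V)
    (hray : ∀ x ∈ V, ∀ r : ℝ, 0 < r → φ (r • x) = φ x) :
    IsHarmonicMorphismOnHyperbolic φ (V ∩ hyperbolicSpace m) := by
  obtain ⟨hV, hsmooth, hharm⟩ := hφ
  refine ⟨Set.inter_subset_right, fun ε hε => ?_⟩
  have hε2 : ε ^ 2 = 1 := by rcases hε with rfl | rfl <;> norm_num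
  have hpre : sheet ε ⁻¹' (V ∩ hyperbolicSpace m) = sheet ε ⁻¹' V := by
    ext y
    simp [sheet_mem_hyperbolicSpace hε2 y]
  rw [hpre]
  refine ⟨hV.preimage (contDiff_sheet (k := 0) ε).continuous,
    hsmooth.comp (contDiff_sheet ε).contDiffOn fun _ hy => hy, ?_⟩
  rintro W f hW ⟨y₀, hy₀⟩ hf
  have hopen : IsOpen (V ∩ φ ⁻¹' W) := hsmooth.continuousOn.isOpen_inter_preimage hV hW
  obtain ⟨hfφ, hlap⟩ := hharm W f hW ⟨sheet ε y₀, hy₀⟩ hf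
  refine ⟨hfφ.comp (contDiff_sheet ε).contDiffOn fun _ hy => hy, fun y hy => ?_⟩
  have hmem : sheet ε y ∈ V ∩ φ ⁻¹' W := hy
  have hconst : ∀ᶠ x in 𝓝 (sheet ε y), ∀ᶠ r : ℝ in 𝓝 1, (f ∘ φ) (r • x) = (f ∘ φ) x := by
    filter_upwards [hopen.mem_nhds hmem] with x hx
    filter_upwards [lt_mem_nhds one_pos] with r hr
    exact congrArg f (hray x hx.1 r hr)
  rw [← Function.comp_assoc, laplaceBeltrami_hyperbolicMetric_comp_sheet hε2
    (hfφ.contDiffAt (hopen.mem_nhds hmem)) hconst, hlap _ hmem]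

end Hyperbolic

section LinearCoordinates

variable {m : ℕ} {F : Type*} [NormedAddCommGroup F] [NormedSpace ℝ F] {L : (Fin m → ℝ) → F}

theorem contDiff_of_isLinearMap (hL : IsLinearMap ℝ L) {k : WithTop ℕ∞} : ContDiff ℝ k L :=
  (LinearMap.toContinuousLinearMap (hL.mk' L)).contDiff

theorem pderiv_of_isLinearMap (hL : IsLinearMap ℝ L) (i : Fin m) (x : Fin m → ℝ) :
    pderiv i L x = L (Pi.single i 1) :=
  congr($((LinearMap.toContinuousLinearMap (hL.mk' L)).fderiv) (Pi.single i 1))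

theorem pderiv_pderiv_of_isLinearMap (hL : IsLinearMap ℝ L) (i j : Fin m) (x : Fin m → ℝ) :
    pderiv i (pderiv j L) x = 0 := by
  simp [funext (pderiv_of_isLinearMap hL j), pderiv]

end LinearCoordinates

section IsotropicCoordinates

variable {n : ℕ}

theorem isLinearMap_firstThree : IsLinearMap ℝ (firstThree (n := n)) :=
  ⟨fun _ _ => rfl, fun _ _ => rfl⟩

theorem isLinearMap_zCoord : IsLinearMap ℝ (zCoord (n := n)) where
  map_add x y := by
    ext k
    simp only [zCoord, Pi.add_apply, Complex.ofReal_add]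
    split_ifs <;> ring
  map_smul r x := by
    ext k
    simp only [zCoord, Pi.smul_apply, smul_eq_mul, Complex.ofReal_mul, Complex.real_smul]
    split_ifs <;> ring

/-- The coefficient of the second of the two real coordinates that make up `z_k`. -/
def zCoeff (k : Fin n) : ℂ := if (k : ℕ) + 1 < n then Complex.I else -1

theorem firstThree_single_initial (i : Fin 3) :
    firstThree (n := n) (Pi.single ⟨i, by omega⟩ 1) = Pi.single i 1 := by
  ext j
  simp [firstThree, Pi.single_apply, Fin.ext_iff]

theorem firstThree_single_add_three (j : ℕ) (hj : j + 3 < 2 * n + 2 + 1) :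
    firstThree (n := n) (Pi.single ⟨j + 3, hj⟩ 1) = 0 := by
  ext i
  have hij : (i : ℕ) ≠ j + 3 := by omega
  simp [firstThree, hij]

theorem zCoord_single_initial (i : Fin 3) :
    zCoord (n := n) (Pi.single ⟨i, by omega⟩ 1) = 0 := by
  ext k
  have hodd : 2 * (k : ℕ) + 3 ≠ i := by omega
  have heven : 2 * (k : ℕ) + 4 ≠ i := by omega
  simp [zCoord, hodd, heven]

theorem zCoord_single_odd (k : Fin n) :
    zCoord (n := n) (Pi.single ⟨2 * k + 3, by omega⟩ 1) = Pi.single k 1 := by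
  ext l
  have hparity : 2 * (l : ℕ) + 4 ≠ 2 * k + 3 := by omega
  rcases eq_or_ne l k with rfl | hlk
  · simp [zCoord]
  · simp [zCoord, hlk, Fin.val_ne_of_ne hlk, hparity]

theorem zCoord_single_even (k : Fin n) :
    zCoord (n := n) (Pi.single ⟨2 * k + 4, by omega⟩ 1) = zCoeff k • Pi.single k 1 := by
  ext l
  have hparity : ¬2 * (l : ℕ) = 2 * k + 1 := by omega
  rcases eq_or_ne l k with rfl | hlk
  · simp [zCoord, zCoeff]
  · simp [zCoord, hlk, Fin.val_ne_of_ne hlk, hparity]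

theorem lorentzSign_of_lt {m : ℕ} {i : Fin (m + 1)} (hi : (i : ℕ) < m) : lorentzSign m i = 1 :=
  lorentzSign_castSucc ⟨i, hi⟩

theorem one_add_lorentzSign_mul_zCoeff_sq (k : Fin n) :
    1 + (lorentzSign (2 * n + 2) ⟨2 * k + 4, by omega⟩ : ℂ) * zCoeff k ^ 2 = 0 := by
  rw [zCoeff]
  split_ifs with hk
  · have hlt : 2 * (k : ℕ) + 4 < 2 * n + 2 := by omega
    rw [lorentzSign_of_lt hlt]
    simp
  · have hlast : (⟨2 * k + 4, by omega⟩ : Fin (2 * n + 2 + 1)) = Fin.last _ :=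
      Fin.ext (by simp only [Fin.val_last]; omega)
    rw [hlast, lorentzSign_last]
    simp

theorem sum_fin_eq_sum_firstThree_add_sum_pairs {M : Type*} [AddCommMonoid M] :
    ∀ (n : ℕ) (a : Fin (2 * n + 2 + 1) → M), ∑ i, a i = ∑ i : Fin 3, a ⟨i, by omega⟩ +
      ∑ k : Fin n, (a ⟨2 * k + 3, by omega⟩ + a ⟨2 * k + 4, by omega⟩)
  | 0, a => by simp
  | n + 1, a => by
    calc
      _ = ∑ i : Fin (2 * n + 2 + 1), a i.castSucc.castSucc + a ⟨2 * n + 3, by omega⟩ +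
          a ⟨2 * n + 4, by omega⟩ := by
        exact (Fin.sum_univ_castSucc (n := 2 * n + 2 + 1 + 1) a).trans
          (congrArg (· + _) (Fin.sum_univ_castSucc fun i => a i.castSucc))
      _ = _ := by
        rw [sum_fin_eq_sum_firstThree_add_sum_pairs n, Fin.sum_univ_castSucc (n := n), add_assoc,
          add_assoc]
        rfl

theorem sum_lorentzSign_smul (hn : 0 < n) {E : Type*} [AddCommGroup E] [Module ℝ E]
    (a : Fin (2 * n + 2 + 1) → E) :
    ∑ i, lorentzSign (2 * n + 2) i • a i = ∑ i : Fin 3, a ⟨i, by omega⟩ +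
      ∑ k : Fin n, (a ⟨2 * k + 3, by omega⟩ +
        lorentzSign (2 * n + 2) ⟨2 * k + 4, by omega⟩ • a ⟨2 * k + 4, by omega⟩) := by
  have hinitial (i : Fin 3) : lorentzSign (2 * n + 2) ⟨i, by omega⟩ = 1 :=
    lorentzSign_of_lt (show (i : ℕ) < 2 * n + 2 by omega)
  have hodd (k : Fin n) : lorentzSign (2 * n + 2) ⟨2 * k + 3, by omega⟩ = 1 :=
    lorentzSign_of_lt (show 2 * (k : ℕ) + 3 < 2 * n + 2 by omega)
  rw [sum_fin_eq_sum_firstThree_add_sum_pairs]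
  simp only [hinitial, hodd, one_smul]

/-- The functions `p(x₁, x₂, x₃)` (at index `none`) and `z_k` (at index `some k`), of which `phiHat`
is a holomorphic function. -/
def isotropicCoord (p : (Fin 3 → ℝ) → ℂ) (x : Fin (2 * n + 2 + 1) → ℝ) (a : Option (Fin n)) : ℂ :=
  a.elim (p (firstThree x)) (zCoord x)

theorem isLinearMap_isotropicCoord_some (p : (Fin 3 → ℝ) → ℂ) (k : Fin n) :
    IsLinearMap ℝ fun x => isotropicCoord p x (some k) :=
  ⟨fun x y => congr_fun (isLinearMap_zCoord.map_add x y) k,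
    fun r x => congr_fun (isLinearMap_zCoord.map_smul r x) k⟩

theorem pderiv_isotropicCoord_some (p : (Fin 3 → ℝ) → ℂ) (i : Fin (2 * n + 2 + 1)) (k : Fin n)
    (x : Fin (2 * n + 2 + 1) → ℝ) :
    pderiv i (fun x => isotropicCoord p x (some k)) x = zCoord (Pi.single i 1) k :=
  pderiv_of_isLinearMap (isLinearMap_isotropicCoord_some p k) i x

variable {p : (Fin 3 → ℝ) → ℂ} {x : Fin (2 * n + 2 + 1) → ℝ}

theorem pderiv_isotropicCoord_none (hp : DifferentiableAt ℝ p (firstThree x))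
    (i : Fin (2 * n + 2 + 1)) :
    pderiv i (fun x => isotropicCoord p x none) x =
      fderiv ℝ p (firstThree x) (firstThree (Pi.single i 1)) := by
  have hcomp := pderiv_comp (u := firstThree) hp
    ((contDiff_of_isLinearMap isLinearMap_firstThree).differentiable one_ne_zero x) i
  rwa [pderiv_of_isLinearMap isLinearMap_firstThree] at hcomp

theorem pderiv_pderiv_isotropicCoord_none (hp : ContDiffAt ℝ 2 p (firstThree x))
    (i : Fin (2 * n + 2 + 1)) :
    pderiv i (pderiv i fun x => isotropicCoord p x none) x =
      fderiv ℝ (fderiv ℝ p) (firstThree x) (firstThree (Pi.single i 1))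
        (firstThree (Pi.single i 1)) := by
  have hcomp := pderiv_pderiv_comp (u := firstThree) hp
    (contDiff_of_isLinearMap isLinearMap_firstThree).contDiffAt i i
  rwa [pderiv_pderiv_of_isLinearMap isLinearMap_firstThree, map_zero, add_zero,
    pderiv_of_isLinearMap isLinearMap_firstThree] at hcomp

theorem contDiffAt_isotropicCoord {r : WithTop ℕ∞} (hp : ContDiffAt ℝ r p (firstThree x)) :
    ContDiffAt ℝ r (isotropicCoord p) x := by
  refine contDiffAt_pi.2 fun a => ?_
  cases a with
  | none => exact hp.comp x (contDiff_of_isLinearMap isLinearMap_firstThree).contDiffAt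
  | some k => exact (contDiff_of_isLinearMap (isLinearMap_isotropicCoord_some p k)).contDiffAt

theorem tensionField_isotropicCoord (hn : 0 < n) (hp : ContDiffAt ℝ 2 p (firstThree x))
    (hharm : ∑ i, pderiv i (pderiv i p) (firstThree x) = 0) :
    tensionField (minkowskiMetric (2 * n + 2)) (isotropicCoord p) x = 0 := by
  ext a
  rw [tensionField_pi (contDiffAt_isotropicCoord hp), tensionField_minkowskiMetric, Pi.zero_apply]
  cases a with
  | none =>
    simp only [pderiv_pderiv_isotropicCoord_none hp, sum_lorentzSign_smul hn,
      firstThree_single_initial, firstThree_single_add_three _ _, map_zero, smul_zero, add_zero,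
      Finset.sum_const_zero]
    simpa only [pderiv_pderiv hp] using hharm
  | some k =>
    simp only [pderiv_pderiv_of_isLinearMap (isLinearMap_isotropicCoord_some p k), smul_zero,
      Finset.sum_const_zero]

theorem conformality_isotropicCoord (hn : 0 < n) (hp : DifferentiableAt ℝ p (firstThree x))
    (hconf : kappa p p (firstThree x) = 0) (a b : Option (Fin n)) :
    conformality (minkowskiMetric (2 * n + 2)) (fun y => isotropicCoord p y a)
      (fun y => isotropicCoord p y b) x = 0 := by
  rw [conformality_minkowskiMetric, sum_lorentzSign_smul hn]
  cases a <;> cases b <;> simp only [pderiv_isotropicCoord_none hp, pderiv_isotropicCoord_some,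
    firstThree_single_initial, firstThree_single_add_three _ _, zCoord_single_initial,
    zCoord_single_odd, zCoord_single_even, map_zero, Pi.zero_apply, mul_zero, zero_mul, smul_zero,
    add_zero, Finset.sum_const_zero]
  case none.none => exact hconf
  case some.some k l =>
    rw [zero_add]
    refine Finset.sum_eq_zero fun j _ => ?_
    simp only [Pi.smul_apply, smul_eq_mul, Complex.real_smul]
    linear_combination (Pi.single j 1 : Fin n → ℂ) k * (Pi.single j 1 : Fin n → ℂ) l *
      one_add_lorentzSign_mul_zCoeff_sq j

theorem isOrthogonalHarmonicFamilyAt_isotropicCoord (hn : 0 < n)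
    (hp : ContDiffAt ℝ ∞ p (firstThree x))
    (hharm : ∑ i, pderiv i (pderiv i p) (firstThree x) = 0)
    (hconf : kappa p p (firstThree x) = 0) :
    IsOrthogonalHarmonicFamilyAt (minkowskiMetric (2 * n + 2)) (isotropicCoord p) x where
  contDiffAt := contDiffAt_isotropicCoord hp
  tensionField_eq_zero := tensionField_isotropicCoord hn (hp.of_le ENat.LEInfty.out) hharm
  conformality_eq_zero := conformality_isotropicCoord hn (hp.differentiableAt (by simp)) hconf

end IsotropicCoordinates

section Quadratic

theorem fderiv_apply_eq_of_forall_add_smul {E F : Type*} [NormedAddCommGroup E] [NormedSpace ℝ E]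
    [NormedAddCommGroup F] [NormedSpace ℝ F] {f : E → F} {x v : E} {A B : F}
    (hf : DifferentiableAt ℝ f x) (h : ∀ t : ℝ, f (x + t • v) = f x + t • A + t ^ 2 • B) :
    fderiv ℝ f x v = A := by
  have hsq : HasDerivAt (fun t : ℝ => t ^ 2) 0 0 := by simpa using hasDerivAt_pow 2 (0 : ℝ)
  have hline : HasDerivAt (fun t : ℝ => f x + t • A + t ^ 2 • B)
      ((1 : ℝ) • A + (0 : ℝ) • B) 0 :=
    (((hasDerivAt_id (0 : ℝ)).smul_const A).const_add (f x)).add (hsq.smul_const B)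
  rw [← hf.lineDeriv_eq_fderiv, lineDeriv, funext h, hline.deriv, one_smul, zero_smul, add_zero]

/-- The polarization `quad (v + w) - quad v - quad w` of the quadratic form `quad`. -/
def quadPolar (a₁ a₂ b₁ b₂ b₃ : ℂ) (v w : Fin 3 → ℝ) : ℂ :=
  2 * a₁ * (v 0 * w 0 - v 1 * w 1) + 2 * a₂ * (v 1 * w 1 - v 2 * w 2)
    + b₁ * (v 0 * w 1 + v 1 * w 0) + b₂ * (v 0 * w 2 + v 2 * w 0) + b₃ * (v 1 * w 2 + v 2 * w 1)

theorem contDiff_ofReal_apply {ι : Type*} [Fintype ι] {k : WithTop ℕ∞} (i : ι) :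
    ContDiff ℝ k fun x : ι → ℝ => (x i : ℂ) :=
  Complex.ofRealCLM.contDiff.comp (contDiff_apply ℝ ℝ i)

variable (a₁ a₂ b₁ b₂ b₃ : ℂ)

theorem contDiff_quad {k : WithTop ℕ∞} : ContDiff ℝ k (quad a₁ a₂ b₁ b₂ b₃) := by
  have hcoord (i : Fin 3) := contDiff_ofReal_apply (k := k) i
  unfold quad
  fun_prop

theorem quad_add_smul (x v : Fin 3 → ℝ) (t : ℝ) :
    quad a₁ a₂ b₁ b₂ b₃ (x + t • v) = quad a₁ a₂ b₁ b₂ b₃ x + t • quadPolar a₁ a₂ b₁ b₂ b₃ x v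
      + t ^ 2 • quad a₁ a₂ b₁ b₂ b₃ v := by
  simp only [quad, quadPolar, Pi.add_apply, Pi.smul_apply, smul_eq_mul, Complex.real_smul,
    Complex.ofReal_add, Complex.ofReal_mul, Complex.ofReal_pow]
  ring

theorem quad_smul (r : ℝ) (x : Fin 3 → ℝ) :
    quad a₁ a₂ b₁ b₂ b₃ (r • x) = (r : ℂ) ^ 2 * quad a₁ a₂ b₁ b₂ b₃ x := by
  simp only [quad, Pi.smul_apply, smul_eq_mul, Complex.ofReal_mul]
  ring

theorem pderiv_quad (i : Fin 3) :
    pderiv i (quad a₁ a₂ b₁ b₂ b₃) = fun x => quadPolar a₁ a₂ b₁ b₂ b₃ x (Pi.single i 1) :=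
  funext fun x => fderiv_apply_eq_of_forall_add_smul
    ((contDiff_quad a₁ a₂ b₁ b₂ b₃).differentiable one_ne_zero x)
    (quad_add_smul a₁ a₂ b₁ b₂ b₃ x (Pi.single i 1))

theorem isLinearMap_quadPolar_left (w : Fin 3 → ℝ) :
    IsLinearMap ℝ fun v => quadPolar a₁ a₂ b₁ b₂ b₃ v w where
  map_add v v' := by
    simp only [quadPolar, Pi.add_apply, Complex.ofReal_add]
    ring
  map_smul r v := by
    simp only [quadPolar, Pi.smul_apply, smul_eq_mul, Complex.ofReal_mul, Complex.real_smul]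
    ring

theorem sum_pderiv_pderiv_quad (x : Fin 3 → ℝ) :
    ∑ i, pderiv i (pderiv i (quad a₁ a₂ b₁ b₂ b₃)) x = 0 := by
  simp only [pderiv_quad, pderiv_of_isLinearMap (isLinearMap_quadPolar_left a₁ a₂ b₁ b₂ b₃ _)]
  simp [Fin.sum_univ_three, quadPolar]

theorem kappa_quad (x : Fin 3 → ℝ) :
    kappa (quad a₁ a₂ b₁ b₂ b₃) (quad a₁ a₂ b₁ b₂ b₃) x =
      (2 * a₁ * x 0 + b₁ * x 1 + b₂ * x 2) ^ 2 + (b₁ * x 0 + 2 * (a₂ - a₁) * x 1 + b₃ * x 2) ^ 2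
        + (b₂ * x 0 + b₃ * x 1 - 2 * a₂ * x 2) ^ 2 := by
  simp only [kappa, pderiv_quad, Fin.sum_univ_three, quadPolar, Pi.single_apply, Fin.reduceEq,
    if_true, if_false, Complex.ofReal_one, Complex.ofReal_zero]
  ring

theorem kappa_quad_eq_zero_iff :
    (∀ x, kappa (quad a₁ a₂ b₁ b₂ b₃) (quad a₁ a₂ b₁ b₂ b₃) x = 0) ↔
      4 * a₁ ^ 2 + b₁ ^ 2 + b₂ ^ 2 = 0 ∧ 4 * a₁ * a₂ = -b₂ ^ 2 ∧ 2 * a₁ * b₃ = b₁ * b₂ ∧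
        4 * a₂ ^ 2 + b₂ ^ 2 + b₃ ^ 2 = 0 := by
  simp only [kappa_quad]
  constructor
  · intro h
    have h₁ : (2 * a₁) ^ 2 + b₁ ^ 2 + b₂ ^ 2 = 0 := by simpa using h ![1, 0, 0]
    have h₂ : b₁ ^ 2 + (2 * (a₂ - a₁)) ^ 2 + b₃ ^ 2 = 0 := by simpa using h ![0, 1, 0]
    have h₃ : b₂ ^ 2 + b₃ ^ 2 + (2 * a₂) ^ 2 = 0 := by simpa using h ![0, 0, 1]
    have h₂₃ : (b₁ + b₂) ^ 2 + (2 * (a₂ - a₁) + b₃) ^ 2 + (b₃ - 2 * a₂) ^ 2 = 0 := by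
      simpa using h ![0, 1, 1]
    exact ⟨by linear_combination h₁, by linear_combination (h₁ + h₃ - h₂) / 2,
      by linear_combination (h₂ + h₃ - h₂₃) / 2, by linear_combination h₃⟩
  · rintro ⟨h₁₁, h₂₂, h₂₃, h₃₃⟩ x
    obtain ⟨h₁₂, h₁₃⟩ : 2 * a₂ * b₁ + b₂ * b₃ = 0 ∧ 2 * a₁ * b₂ + b₁ * b₃ - 2 * a₂ * b₂ = 0 := by
      rcases eq_or_ne a₁ 0 with rfl | ha
      · have hb₂ : b₂ = 0 := by simpa using h₂₂
        have hb₁ : b₁ = 0 := by simpa [hb₂] using h₁₁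
        simp [hb₁, hb₂]
      · constructor <;> refine (mul_eq_zero.1 (?_ : 2 * a₁ * _ = 0)).resolve_left (by simpa)
        · linear_combination b₁ * h₂₂ + b₂ * h₂₃
        · linear_combination b₂ * h₁₁ + b₁ * h₂₃ - b₂ * h₂₂
    linear_combination x 0 ^ 2 * h₁₁ + x 1 ^ 2 * (h₁₁ + h₃₃ - 2 * h₂₂) + x 2 ^ 2 * h₃₃
      + 2 * x 0 * x 1 * h₁₂ + 2 * x 0 * x 2 * h₁₃ - 2 * x 1 * x 2 * h₂₃

end Quadratic

section PhiHat

variable {n : ℕ}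

theorem analyticAt_eval_mvPolynomial {E σ : Type*} [NormedAddCommGroup E] [NormedSpace ℂ E]
    {g : E → σ → ℂ} {y : E} (hg : ∀ i, AnalyticAt ℂ (fun y => g y i) y) (P : MvPolynomial σ ℂ) :
    AnalyticAt ℂ (fun y => MvPolynomial.eval (g y) P) y := by
  simpa only [MvPolynomial.aeval_eq_eval] using AnalyticAt.aeval_mvPolynomial hg P

theorem cpow_half_of_even {d : ℕ} (hd : Even d) (w : ℂ) : w ^ ((d : ℂ) / 2) = w ^ (d / 2) := by
  rw [← Complex.cpow_natCast, Nat.cast_div hd.two_dvd two_ne_zero, Nat.cast_ofNat]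

theorem analyticAt_cpow_half {E : Type*} [NormedAddCommGroup E] [NormedSpace ℂ E] {d : ℕ}
    {g : E → ℂ} {y : E} (hg : AnalyticAt ℂ g y) (hy : Odd d → g y ∈ Complex.slitPlane) :
    AnalyticAt ℂ (fun y => g y ^ ((d : ℂ) / 2)) y := by
  rcases Nat.even_or_odd d with hd | hd
  · simpa only [cpow_half_of_even hd] using hg.fun_pow (d / 2)
  · exact hg.cpow analyticAt_const (hy hd)

theorem continuous_lorentz_self {m : ℕ} : Continuous fun x : Fin (m + 1) → ℝ => lorentz x x := by
  unfold lorentz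
  fun_prop

theorem isOpen_timelikeCone (m : ℕ) : IsOpen (timelikeCone m) :=
  isOpen_lt continuous_lorentz_self continuous_const

theorem isOpen_phiHatDomain {p : (Fin 3 → ℝ) → ℂ} (hp : Continuous p) (d : ℕ)
    (Q : MvPolynomial (Fin n) ℂ) : IsOpen (phiHatDomain d p Q) := by
  have hz : Continuous (zCoord (n := n)) :=
    (contDiff_of_isLinearMap isLinearMap_zCoord (k := 0)).continuous
  have hfirst : Continuous (firstThree (n := n)) :=
    (contDiff_of_isLinearMap isLinearMap_firstThree (k := 0)).continuous
  have hslit : IsOpen {x | Odd d → p (firstThree (n := n) x) ∈ Complex.slitPlane} := by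
    simp only [imp_iff_not_or, Set.ofPred_or]
    exact isOpen_const.union (Complex.isOpen_slitPlane.preimage (hp.comp hfirst))
  exact (isOpen_timelikeCone _).inter <|
    (isOpen_ne_fun ((MvPolynomial.continuous_eval Q).comp hz) continuous_const).inter hslit

theorem isHarmonicMorphismOn_phiHat (hn : 0 < n) {p : (Fin 3 → ℝ) → ℂ} (hp : ContDiff ℝ ∞ p)
    (hharm : ∀ x, ∑ i, pderiv i (pderiv i p) x = 0) (hconf : ∀ x, kappa p p x = 0) (d : ℕ)
    (P Q : MvPolynomial (Fin n) ℂ) :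
    IsHarmonicMorphismOn (minkowskiMetric (2 * n + 2)) (phiHat d p P Q) (phiHatDomain d p Q) := by
  have hcoord (a : Option (Fin n)) (w : Option (Fin n) → ℂ) :
      AnalyticAt ℂ (fun w : Option (Fin n) → ℂ => w a) w :=
    (ContinuousLinearMap.proj (R := ℂ) (φ := fun _ => ℂ) a).analyticAt w
  refine isHarmonicMorphismOn_minkowskiMetric_comp (ψ := isotropicCoord p)
    (F := fun w => (w none ^ ((d : ℂ) / 2) + MvPolynomial.eval (fun k => w (some k)) P) /
      MvPolynomial.eval (fun k => w (some k)) Q)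
    (isOpen_phiHatDomain hp.continuous d Q)
    (fun x _ => isOrthogonalHarmonicFamilyAt_isotropicCoord hn hp.contDiffAt (hharm _) (hconf _))
    fun x hx => ?_
  have heval (R : MvPolynomial (Fin n) ℂ) :=
    analyticAt_eval_mvPolynomial (fun k => hcoord (some k) (isotropicCoord p x)) R
  exact ((analyticAt_cpow_half (hcoord none _) hx.2.2).add (heval P)).div (heval Q) hx.2.1

end PhiHat

section Homogeneity

theorem lorentz_smul {m : ℕ} (r : ℝ) (x : Fin (m + 1) → ℝ) :
    lorentz (r • x) (r • x) = r ^ 2 * lorentz x x := by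
  simp only [lorentz, Pi.smul_apply, smul_eq_mul, mul_add, Finset.mul_sum]
  congr 1
  · ring
  · exact Finset.sum_congr rfl fun k _ => by ring

theorem smul_mem_timelikeCone {m : ℕ} {x : Fin (m + 1) → ℝ} (hx : x ∈ timelikeCone m) {r : ℝ}
    (hr : r ≠ 0) : r • x ∈ timelikeCone m :=
  (lorentz_smul r x).trans_lt (mul_neg_of_pos_of_neg (by positivity) hx)

theorem smul_mem_slitPlane {r : ℝ} (hr : 0 < r) {w : ℂ} (hw : w ∈ Complex.slitPlane) :
    (r : ℂ) * w ∈ Complex.slitPlane := by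
  simpa [Complex.mem_slitPlane_iff, hr, hr.ne'] using hw

theorem eval_smul_of_isHomogeneous {σ R : Type*} [CommSemiring R] {P : MvPolynomial σ R} {d : ℕ}
    (hP : P.IsHomogeneous d) (r : R) (z : σ → R) :
    MvPolynomial.eval (r • z) P = r ^ d * MvPolynomial.eval z P := by
  rw [MvPolynomial.eval_eq, MvPolynomial.eval_eq, Finset.mul_sum]
  refine Finset.sum_congr rfl fun s hs => ?_
  have hdeg : ∑ i ∈ s.support, s i = d := (hP.degree_eq_sum_deg_support hs).symm
  simp only [Pi.smul_apply, smul_eq_mul, mul_pow, Finset.prod_mul_distrib,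
    Finset.prod_pow_eq_pow_sum, hdeg]
  ring

theorem ofReal_mul_cpow {r : ℝ} (hr : 0 < r) (w s : ℂ) :
    ((r : ℂ) * w) ^ s = (r : ℂ) ^ s * w ^ s := by
  have hr₀ : (r : ℂ) ≠ 0 := Complex.ofReal_ne_zero.2 hr.ne'
  rcases eq_or_ne w 0 with rfl | hw
  · rcases eq_or_ne s 0 with rfl | hs
    · simp
    · simp [Complex.zero_cpow hs]
  · rw [Complex.cpow_def_of_ne_zero (mul_ne_zero hr₀ hw), Complex.cpow_def_of_ne_zero hr₀,
      Complex.cpow_def_of_ne_zero hw, Complex.log_ofReal_mul hr hw, Complex.ofReal_log hr.le,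
      add_mul, Complex.exp_add]

theorem sq_mul_cpow_half {r : ℝ} (hr : 0 < r) (w : ℂ) (d : ℕ) :
    ((r : ℂ) ^ 2 * w) ^ ((d : ℂ) / 2) = (r : ℂ) ^ d * w ^ ((d : ℂ) / 2) := by
  have harg : (r : ℂ).arg = 0 := Complex.arg_ofReal_of_nonneg hr.le
  rw [← Complex.ofReal_pow, ofReal_mul_cpow (pow_pos hr 2), Complex.ofReal_pow,
    ← Complex.cpow_ofNat_mul' (by simp [harg, Real.pi_pos]) (by simp [harg, Real.pi_pos.le]),
    mul_div_cancel₀ _ two_ne_zero, Complex.cpow_natCast]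

variable {n d : ℕ} {p : (Fin 3 → ℝ) → ℂ} {P Q : MvPolynomial (Fin n) ℂ}

theorem smul_mem_phiHatDomain (hp : ∀ (r : ℝ) x, p (r • x) = (r : ℂ) ^ 2 * p x)
    (hQ : Q.IsHomogeneous d) {x : Fin (2 * n + 2 + 1) → ℝ} (hx : x ∈ phiHatDomain d p Q) {r : ℝ}
    (hr : 0 < r) : r • x ∈ phiHatDomain d p Q := by
  obtain ⟨hcone, hne, hslit⟩ := hx
  refine ⟨smul_mem_timelikeCone hcone hr.ne', ?_, fun hd => ?_⟩
  · rw [isLinearMap_zCoord.map_smul, ← Complex.coe_smul, eval_smul_of_isHomogeneous hQ]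
    exact mul_ne_zero (pow_ne_zero _ (Complex.ofReal_ne_zero.2 hr.ne')) hne
  · rw [isLinearMap_firstThree.map_smul, hp, ← Complex.ofReal_pow]
    exact smul_mem_slitPlane (pow_pos hr 2) (hslit hd)

theorem phiHat_smul (hp : ∀ (r : ℝ) x, p (r • x) = (r : ℂ) ^ 2 * p x) (hP : P.IsHomogeneous d)
    (hQ : Q.IsHomogeneous d) (x : Fin (2 * n + 2 + 1) → ℝ) {r : ℝ} (hr : 0 < r) :
    phiHat d p P Q (r • x) = phiHat d p P Q x := by
  have hrd : (r : ℂ) ^ d ≠ 0 := pow_ne_zero _ (Complex.ofReal_ne_zero.2 hr.ne')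
  rw [phiHat, isLinearMap_firstThree.map_smul, hp, isLinearMap_zCoord.map_smul, ← Complex.coe_smul,
    eval_smul_of_isHomogeneous hP, eval_smul_of_isHomogeneous hQ, sq_mul_cpow_half hr, ← mul_add,
    mul_div_mul_left _ _ hrd, phiHat]

end Homogeneity

section RadialProjection

variable {m : ℕ}

theorem hyperbolicSpace_subset_timelikeCone : hyperbolicSpace m ⊆ timelikeCone m :=
  fun _ hx => (show _ = _ from hx).trans_lt neg_one_lt_zero

theorem inv_sqrt_neg_lorentz_pos {x : Fin (m + 1) → ℝ} (hx : x ∈ timelikeCone m) :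
    0 < (√(-lorentz x x))⁻¹ :=
  inv_pos.2 (Real.sqrt_pos.2 (neg_pos.2 hx))

theorem radialProj_mem_hyperbolicSpace {x : Fin (m + 1) → ℝ} (hx : x ∈ timelikeCone m) :
    radialProj x ∈ hyperbolicSpace m := by
  have hpos : 0 < -lorentz x x := neg_pos.2 hx
  rw [hyperbolicSpace, Set.mem_ofPred_eq, radialProj, lorentz_smul, inv_pow, Real.sq_sqrt hpos.le,
    inv_mul_eq_iff_eq_mul₀ hpos.ne']
  ring

theorem radialProj_of_mem_hyperbolicSpace {x : Fin (m + 1) → ℝ} (hx : x ∈ hyperbolicSpace m) :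
    radialProj x = x := by
  have hnorm : lorentz x x = -1 := hx
  simp [radialProj, hnorm]

theorem image_radialProj {V : Set (Fin (m + 1) → ℝ)} (hV : V ⊆ timelikeCone m)
    (hcone : ∀ x ∈ V, ∀ r : ℝ, 0 < r → r • x ∈ V) : radialProj '' V = V ∩ hyperbolicSpace m := by
  ext x
  constructor
  · rintro ⟨y, hy, rfl⟩
    exact ⟨hcone y hy _ (inv_sqrt_neg_lorentz_pos (hV hy)), radialProj_mem_hyperbolicSpace (hV hy)⟩
  · exact fun hx => ⟨x, hx.1, radialProj_of_mem_hyperbolicSpace hx.2⟩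

theorem sq_castSucc_lt_sq_last {x : Fin (m + 1) → ℝ} (hx : x ∈ timelikeCone m) (i : Fin m) :
    x i.castSucc ^ 2 < x (Fin.last m) ^ 2 := by
  have hlorentz : lorentz x x < 0 := hx
  have hle := Finset.single_le_sum (f := fun k : Fin m => x k.castSucc * x k.castSucc)
    (fun _ _ => mul_self_nonneg _) (Finset.mem_univ i)
  rw [lorentz] at hlorentz
  linarith

theorem zCoord_last_ne_zero {n : ℕ} (hn : 0 < n) {x : Fin (2 * n + 2 + 1) → ℝ}
    (hx : x ∈ timelikeCone (2 * n + 2)) : zCoord x ⟨n - 1, by omega⟩ ≠ 0 := by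
  have hodd : (⟨2 * (n - 1) + 3, by omega⟩ : Fin (2 * n + 2 + 1)) =
      Fin.castSucc ⟨2 * n + 1, by omega⟩ :=
    Fin.ext (show 2 * (n - 1) + 3 = 2 * n + 1 by omega)
  have heven : (⟨2 * (n - 1) + 4, by omega⟩ : Fin (2 * n + 2 + 1)) = Fin.last (2 * n + 2) :=
    Fin.ext (show 2 * (n - 1) + 4 = 2 * n + 2 by omega)
  intro hzero
  rw [zCoord, if_neg (by simp only; omega), sub_eq_zero, Complex.ofReal_inj, hodd, heven] at hzero
  exact (sq_castSucc_lt_sq_last hx _).ne (congrArg (· ^ 2) hzero)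

theorem phiHatDomain_eq_timelikeCone {n d : ℕ} (hn : 0 < n) (hd : Even d) (p : (Fin 3 → ℝ) → ℂ) :
    phiHatDomain d p (MvPolynomial.X ⟨n - 1, by omega⟩ ^ d : MvPolynomial (Fin n) ℂ) =
      timelikeCone (2 * n + 2) := by
  refine Set.Subset.antisymm (fun x hx => hx.1) fun x hx => ⟨hx, ?_, fun hodd => ?_⟩
  · rw [map_pow, MvPolynomial.eval_X]
    exact pow_ne_zero _ (zCoord_last_ne_zero hn hx)
  · exact absurd hd (Nat.not_even_iff_odd.2 hodd)

end RadialProjection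

end HarmonicMorphism

end

theorem mainTheorem4 (n d : ℕ) (hn : 0 < n) (hd : 0 < d) (a₁ a₂ b₁ b₂ b₃ : ℂ)
    (P Q : MvPolynomial (Fin n) ℂ) (hP : P.IsHomogeneous d) (hQ : Q.IsHomogeneous d) :
    ((∀ x, kappa (quad a₁ a₂ b₁ b₂ b₃) (quad a₁ a₂ b₁ b₂ b₃) x = 0) ↔
      4 * a₁ ^ 2 + b₁ ^ 2 + b₂ ^ 2 = 0 ∧ 4 * a₁ * a₂ = -b₂ ^ 2 ∧ 2 * a₁ * b₃ = b₁ * b₂ ∧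
        4 * a₂ ^ 2 + b₂ ^ 2 + b₃ ^ 2 = 0) ∧
    ((∀ x, kappa (quad a₁ a₂ b₁ b₂ b₃) (quad a₁ a₂ b₁ b₂ b₃) x = 0) →
      IsHarmonicMorphismOn (minkowskiMetric (2 * n + 2))
        (phiHat d (quad a₁ a₂ b₁ b₂ b₃) P Q) (phiHatDomain d (quad a₁ a₂ b₁ b₂ b₃) Q) ∧
      (∀ x ∈ phiHatDomain d (quad a₁ a₂ b₁ b₂ b₃) Q, ∀ r : ℝ, 0 < r →
        r • x ∈ phiHatDomain d (quad a₁ a₂ b₁ b₂ b₃) Q ∧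
        phiHat d (quad a₁ a₂ b₁ b₂ b₃) P Q (r • x) = phiHat d (quad a₁ a₂ b₁ b₂ b₃) P Q x) ∧
      (∃ Φ : (Fin (2 * n + 2 + 1) → ℝ) → ℂ,
        (∀ x ∈ phiHatDomain d (quad a₁ a₂ b₁ b₂ b₃) Q,
          Φ (radialProj x) = phiHat d (quad a₁ a₂ b₁ b₂ b₃) P Q x) ∧
        IsHarmonicMorphismOnHyperbolic Φ
          (radialProj '' phiHatDomain d (quad a₁ a₂ b₁ b₂ b₃) Q)) ∧
      (Even d → Q = MvPolynomial.X ⟨n - 1, by omega⟩ ^ d →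
        phiHatDomain d (quad a₁ a₂ b₁ b₂ b₃) Q = timelikeCone (2 * n + 2) ∧
        radialProj '' phiHatDomain d (quad a₁ a₂ b₁ b₂ b₃) Q =
          hyperbolicSpace (2 * n + 2))) := by
  refine ⟨kappa_quad_eq_zero_iff a₁ a₂ b₁ b₂ b₃, fun hκ => ?_⟩
  have hp := quad_smul a₁ a₂ b₁ b₂ b₃
  have hcone : ∀ x ∈ phiHatDomain d (quad a₁ a₂ b₁ b₂ b₃) Q, ∀ r : ℝ, 0 < r →
      r • x ∈ phiHatDomain d (quad a₁ a₂ b₁ b₂ b₃) Q :=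
    fun _ hx _ hr => smul_mem_phiHatDomain hp hQ hx hr
  have hV : phiHatDomain d (quad a₁ a₂ b₁ b₂ b₃) Q ⊆ timelikeCone (2 * n + 2) := fun _ hx => hx.1
  have himage := image_radialProj hV hcone
  have hφ := isHarmonicMorphismOn_phiHat hn (contDiff_quad a₁ a₂ b₁ b₂ b₃)
    (sum_pderiv_pderiv_quad a₁ a₂ b₁ b₂ b₃) hκ d P Q
  refine ⟨hφ, fun x hx r hr => ⟨hcone x hx r hr, phiHat_smul hp hP hQ x hr⟩,
    ⟨phiHat d (quad a₁ a₂ b₁ b₂ b₃) P Q, fun x hx => ?_, ?_⟩, ?_⟩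
  · exact phiHat_smul hp hP hQ x (inv_sqrt_neg_lorentz_pos (hV hx))
  · rw [himage]
    exact isHarmonicMorphismOnHyperbolic_of_minkowski hφ fun x _ _ hr => phiHat_smul hp hP hQ x hr
  · rintro hd rfl
    have hdomain := phiHatDomain_eq_timelikeCone hn hd (quad a₁ a₂ b₁ b₂ b₃)
    rw [himage, hdomain]
    exact ⟨rfl, Set.inter_eq_right.2 hyperbolicSpace_subset_timelikeCone⟩
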